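/- A real $n\times n$ matrix is SDDM if it is symmetric, nonsingular, has non-positive off-diagonal entries, and each diagonal entry is at least the sum of the absolute values of the other entries in its row. For symmetric matrices write $A \approx_\epsilon B$ if both $e^{\epsilon}B - A$ and $A - e^{-\epsilon}B$ are positive semidefinite. There is an absolute constant $C$ such that for every $n$ and every $n\times n$ SDDM matrix $M$ there are an ordering of the indices (a permutation matrix $P$), a diagonal matrix $D$ and an upper-triangular matrix $U$ with at most $Cn$ nonzero entries such that $$U^{T} D U \approx_2 P^{T} M P .$$ Moreover, back solves ($Ux=b$ for arbitrary $b$) and forward solves ($U^{T}x=b$ for arbitrary $b$) can each be performed with work at most $Cn$ and depth at most $C\log^2 n$: for each of the two there is an arithmetic circuit, with inputs the entries of $U$ and of $b$, with at most $Cn$ gates of fan-in two from $\{+,-,\times,/\}$ and depth at most $C\log^2 n$, that outputs the solution $x$ for every $b$ without ever dividing by zero. -/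

import Mathlib

open scoped Matrix

/-- SDDM matrices: symmetric, diagonally dominant, non-positive off-diagonal entries,
nonsingular. -/
structure IsSDDM {n : ℕ} (M : Matrix (Fin n) (Fin n) ℝ) : Prop where
  symm : M.IsSymm
  diagDominant : ∀ i, ∑ j ∈ Finset.univ.erase i, |M i j| ≤ M i i
  offDiag_nonpos : ∀ i j, i ≠ j → M i j ≤ 0
  nonsingular : IsUnit M.det

/-- `A ≈_ε B`, that is `e^ε B ≽ A ≽ e^{-ε} B` in the Loewner order. -/
def SpectralApprox {n : ℕ} (ε : ℝ) (A B : Matrix (Fin n) (Fin n) ℝ) : Prop :=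
  (Real.exp ε • B - A).PosSemidef ∧ (A - Real.exp (-ε) • B).PosSemidef

/-- The number of nonzero entries of a matrix. -/
noncomputable def numNonzero {n : ℕ} (A : Matrix (Fin n) (Fin n) ℝ) : ℕ :=
  {p : Fin n × Fin n | A p.1 p.2 ≠ 0}.ncard

/-- The binary arithmetic operations; each costs one unit of work and one unit of depth. -/
inductive ArithOp where
  | add
  | sub
  | mul
  | div

/-- The value of an operation on two reals. -/
noncomputable def ArithOp.apply : ArithOp → ℝ → ℝ → ℝ
  | .add, a, b => a + b
  | .sub, a, b => a - b
  | .mul, a, b => a * b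
  | .div, a, b => a / b

/-- Arithmetic circuits with `s` gates of fan-in two over the inputs `ι`, without constants:
every new gate reads two wires, each of which is an input or one of the gates present
before it. The work of the circuit is its number `s` of gates. -/
inductive ArithCircuit (ι : Type) : ℕ → Type where
  | nil : ArithCircuit ι 0
  | snoc {s : ℕ} (c : ArithCircuit ι s) (op : ArithOp) (l r : ι ⊕ Fin s) :
      ArithCircuit ι (s + 1)

namespace ArithCircuit

/-- The values at the gates, for the input values `x`. -/
noncomputable def gateValue {ι : Type} (x : ι → ℝ) :
    {s : ℕ} → ArithCircuit ι s → Fin s → ℝ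
  | _, nil => Fin.elim0
  | _, snoc c op l r =>
      Fin.snoc (α := fun _ => ℝ) (gateValue x c)
        (op.apply (Sum.elim x (gateValue x c) l) (Sum.elim x (gateValue x c) r))

/-- The value at a wire, which is an input or a gate. -/
noncomputable def value {ι : Type} {s : ℕ} (c : ArithCircuit ι s) (x : ι → ℝ)
    (w : ι ⊕ Fin s) : ℝ :=
  Sum.elim x (c.gateValue x) w

/-- No division gate divides by zero on the input values `x`. -/
def DivSafe {ι : Type} (x : ι → ℝ) : {s : ℕ} → ArithCircuit ι s → Prop
  | _, nil => True
  | _, snoc c op _ r => DivSafe x c ∧ (op = ArithOp.div → c.value x r ≠ 0)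

/-- The depth of each gate: the largest number of gates on a directed path ending there. -/
def gateDepth {ι : Type} : {s : ℕ} → ArithCircuit ι s → Fin s → ℕ
  | _, nil => Fin.elim0
  | _, snoc c _ l r =>
      Fin.snoc (α := fun _ => ℕ) (gateDepth c)
        (max (Sum.elim (fun _ => 0) (gateDepth c) l)
          (Sum.elim (fun _ => 0) (gateDepth c) r) + 1)

/-- The depth of the circuit: the largest number of gates on a directed path. -/
def depth {ι : Type} {s : ℕ} (c : ArithCircuit ι s) : ℕ :=
  Finset.univ.sup c.gateDepth

end ArithCircuit

/-- Linear systems in `A` can be solved with the given work and depth: some arithmetic circuit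
within these bounds, whose inputs are the entries of `A` and those of the right-hand side `b`,
outputs a solution `x` of `A x = b` for every `b`, never dividing by zero. -/
def SolvableIn {n : ℕ} (A : Matrix (Fin n) (Fin n) ℝ) (work depth : ℝ) : Prop :=
  ∃ (s : ℕ) (c : ArithCircuit ((Fin n × Fin n) ⊕ Fin n) s)
    (out : Fin n → ((Fin n × Fin n) ⊕ Fin n) ⊕ Fin s),
    (s : ℝ) ≤ work ∧ (c.depth : ℝ) ≤ depth ∧
      ∀ b : Fin n → ℝ,
        c.DivSafe (Sum.elim (fun p => A p.1 p.2) b) ∧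
          A *ᵥ (fun i => c.value (Sum.elim (fun p => A p.1 p.2) b) (out i)) = b

/-!
Up to its excess diagonal, an SDDM matrix is the Laplacian of a weighted graph, a nonnegative
combination of rank-one matrices. By the barrier argument of Batson, Spielman and Srivastava it is
therefore within a factor `1 + 10 / q` of an SDDM matrix with `O(q ^ 2)` nonzero entries per row on
average. Half of the rows have a number of nonzero entries of this order. In a `5`-coloring of the
vertices that minimizes the weight of the monochromatic edges, every vertex keeps at most a fifth of
its weight inside its color class. So some class contains a tenth of all vertices, of low degree and
spanning a block that is dominated by its excess diagonal.

Jacobi iterates for such a block converge geometrically. Replacing the inverse of the block by a few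
of them makes its elimination both sparse and accurate, and leaves the exact Schur complement, which
is again SDDM and on which the argument is repeated. At depth `j` of this recursion the parameter
`q` is of order `j ^ 2` and the number of iterates of order `log j`. The relative errors are then of
order `1 / j ^ 2`, so that their product stays bounded, while the fill `exp (O(log j ^ 2))` per row
is summable against the dimension, which shrinks like `(9 / 10) ^ j`.

The coupling of each block to the rest is kept explicitly and the block itself has become diagonal,
so all unknowns of a round can be solved for at once, by binary trees of additions of depth
`O(log n)`. There are `O(log n)` rounds.
-/

/-! ## Quadratic forms -/

section QuadForm

open Matrix

variable {V W : Type*}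

theorem isSymm_of_posSemidef {M : Matrix V V ℝ} (hM : M.PosSemidef) : M.IsSymm :=
  isHermitian_iff_isSymm.1 hM.isHermitian

theorem vecMulVec_self_isSymm (v : V → ℝ) : (vecMulVec v v).IsSymm :=
  transpose_vecMulVec v v

theorem transpose_mul_vecMulVec_self_mul [Fintype W] (w : W → ℝ) (T : Matrix W V ℝ) :
    Tᵀ * vecMulVec w w * T = vecMulVec (w ᵥ* T) (w ᵥ* T) := by
  rw [mul_vecMulVec, vecMulVec_mul, mulVec_transpose]

variable [Fintype V] [Fintype W]

/-- The quadratic form `xᵀ M x` of a real matrix. -/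
def quadForm (M : Matrix V V ℝ) (x : V → ℝ) : ℝ :=
  x ⬝ᵥ M *ᵥ x

/-- The two-sided comparison `A ≼ a B` and `B ≼ b A` of quadratic forms. The approximations of the
argument are composed through it, with explicit factors; only the last one is put in the form
`SpectralApprox`. -/
def SpectralBounds (a b : ℝ) (A B : Matrix V V ℝ) : Prop :=
  ∀ x, quadForm A x ≤ a * quadForm B x ∧ quadForm B x ≤ b * quadForm A x

@[simp]
theorem quadForm_zero (M : Matrix V V ℝ) : quadForm M 0 = 0 := by
  simp [quadForm]

theorem quadForm_add (A B : Matrix V V ℝ) (x : V → ℝ) :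
    quadForm (A + B) x = quadForm A x + quadForm B x := by
  simp only [quadForm, add_mulVec, dotProduct_add]

theorem quadForm_sub (A B : Matrix V V ℝ) (x : V → ℝ) :
    quadForm (A - B) x = quadForm A x - quadForm B x := by
  simp only [quadForm, sub_mulVec, dotProduct_sub]

theorem quadForm_smul (c : ℝ) (A : Matrix V V ℝ) (x : V → ℝ) :
    quadForm (c • A) x = c * quadForm A x := by
  simp only [quadForm, smul_mulVec, dotProduct_smul, smul_eq_mul]

theorem quadForm_diagonal [DecidableEq V] (d x : V → ℝ) :
    quadForm (diagonal d) x = ∑ i, d i * x i ^ 2 := by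
  simp only [quadForm, dotProduct, mulVec_diagonal]
  exact Finset.sum_congr rfl fun i _ => by ring

theorem quadForm_one [DecidableEq V] (x : V → ℝ) : quadForm 1 x = x ⬝ᵥ x := by
  rw [quadForm, one_mulVec]

theorem quadForm_vecMulVec_self (v x : V → ℝ) : quadForm (vecMulVec v v) x = (v ⬝ᵥ x) ^ 2 := by
  simp [quadForm, vecMulVec_mulVec, dotProduct_comm x v, sq]

theorem quadForm_transpose_mul_mul (T : Matrix W V ℝ) (A : Matrix W W ℝ) (x : V → ℝ) :
    quadForm (Tᵀ * A * T) x = quadForm A (T *ᵥ x) := by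
  rw [quadForm, ← mulVec_mulVec, ← mulVec_mulVec, dotProduct_mulVec, vecMul_transpose, quadForm]

theorem quadForm_submatrix (A : Matrix V V ℝ) (e : W ≃ V) (x : W → ℝ) :
    quadForm (A.submatrix e e) x = quadForm A (x ∘ e.symm) := by
  rw [quadForm, submatrix_mulVec_equiv, ← comp_equiv_symm_dotProduct, quadForm]

theorem dotProduct_mulVec_comm {M : Matrix V V ℝ} (hM : M.IsSymm) (x y : V → ℝ) :
    x ⬝ᵥ M *ᵥ y = y ⬝ᵥ M *ᵥ x := by
  rw [dotProduct_comm, dotProduct_mulVec, ← mulVec_transpose, hM.eq]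

theorem quadForm_neg_vec (M : Matrix V V ℝ) (x : V → ℝ) : quadForm M (-x) = quadForm M x := by
  simp only [quadForm, mulVec_neg, dotProduct_neg, neg_dotProduct, neg_neg]

theorem quadForm_smul_vec (M : Matrix V V ℝ) (c : ℝ) (x : V → ℝ) :
    quadForm M (c • x) = c ^ 2 * quadForm M x := by
  simp only [quadForm, mulVec_smul, dotProduct_smul, smul_dotProduct, smul_eq_mul]
  ring

theorem quadForm_add_vec {M : Matrix V V ℝ} (hM : M.IsSymm) (x y : V → ℝ) :
    quadForm M (x + y) = quadForm M x + 2 * (x ⬝ᵥ M *ᵥ y) + quadForm M y := by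
  simp only [quadForm, mulVec_add, dotProduct_add, add_dotProduct, dotProduct_mulVec_comm hM y x]
  ring

theorem quadForm_nonneg {M : Matrix V V ℝ} (hM : M.PosSemidef) (x : V → ℝ) : 0 ≤ quadForm M x := by
  simpa [quadForm] using hM.dotProduct_mulVec_nonneg x

theorem quadForm_pos {M : Matrix V V ℝ} (hM : M.PosDef) {x : V → ℝ} (hx : x ≠ 0) :
    0 < quadForm M x := by
  simpa [quadForm] using hM.dotProduct_mulVec_pos hx

theorem posSemidef_of_quadForm_nonneg {M : Matrix V V ℝ} (hM : M.IsSymm)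
    (h : ∀ x, 0 ≤ quadForm M x) : M.PosSemidef :=
  .of_dotProduct_mulVec_nonneg (isHermitian_iff_isSymm.2 hM) (by simpa [quadForm] using h)

theorem posDef_of_quadForm_pos {M : Matrix V V ℝ} (hM : M.IsSymm)
    (h : ∀ x, x ≠ 0 → 0 < quadForm M x) : M.PosDef :=
  .of_dotProduct_mulVec_pos (isHermitian_iff_isSymm.2 hM) (by simpa [quadForm] using h)

theorem sq_le_mul_of_forall_quadratic_nonneg {a b c : ℝ}
    (h : ∀ t : ℝ, 0 ≤ a * t ^ 2 + 2 * b * t + c) : b ^ 2 ≤ a * c := by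
  have hdiscrim := discrim_le_zero (a := a) (b := 2 * b) (c := c) fun t => by
    simpa only [sq] using h t
  rw [discrim] at hdiscrim
  linarith

theorem dotProduct_mulVec_sq_le {M : Matrix V V ℝ} (hM : M.PosSemidef) (x y : V → ℝ) :
    (x ⬝ᵥ M *ᵥ y) ^ 2 ≤ quadForm M x * quadForm M y := by
  rw [mul_comm]
  refine sq_le_mul_of_forall_quadratic_nonneg fun t => ?_
  calc 0 ≤ quadForm M (x + t • y) := quadForm_nonneg hM _
    _ = quadForm M y * t ^ 2 + 2 * (x ⬝ᵥ M *ᵥ y) * t + quadForm M x := by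
      rw [quadForm_add_vec (isSymm_of_posSemidef hM), quadForm_smul_vec, mulVec_smul,
        dotProduct_smul, smul_eq_mul]
      ring

theorem isUnit_det_of_posDef [DecidableEq V] {M : Matrix V V ℝ} (hM : M.PosDef) : IsUnit M.det :=
  (isUnit_iff_isUnit_det M).1 hM.isUnit

theorem dotProduct_sq_le_quadForm_inv_mul [DecidableEq V] {M : Matrix V V ℝ} (hM : M.PosDef)
    (v x : V → ℝ) : (v ⬝ᵥ x) ^ 2 ≤ quadForm M⁻¹ v * quadForm M x := by
  have hcancel : M *ᵥ M⁻¹ *ᵥ v = v := by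
    rw [mulVec_mulVec, mul_nonsing_inv _ (isUnit_det_of_posDef hM), one_mulVec]
  have hdual : quadForm M (M⁻¹ *ᵥ v) = quadForm M⁻¹ v := by
    rw [quadForm, hcancel, dotProduct_comm, quadForm]
  have h := dotProduct_mulVec_sq_le hM.posSemidef x (M⁻¹ *ᵥ v)
  rwa [hcancel, hdual, dotProduct_comm, mul_comm] at h

open scoped MatrixOrder Matrix.Norms.L2Operator in
theorem exists_eq_transpose_mul_self {M : Matrix V V ℝ} (hM : M.PosSemidef) :
    ∃ B : Matrix V V ℝ, M = Bᵀ * B := by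
  classical
  exact CStarAlgebra.nonneg_iff_eq_star_mul_self.1 hM.nonneg

theorem isUnit_det_of_isUnit_det_transpose_mul_self [DecidableEq V] {B : Matrix V V ℝ}
    (h : IsUnit (Bᵀ * B).det) : IsUnit B.det :=
  isUnit_of_mul_isUnit_right (det_mul Bᵀ B ▸ h)

namespace SpectralBounds

variable {a b a' b' : ℝ} {A B C : Matrix V V ℝ}

theorem refl (A : Matrix V V ℝ) : SpectralBounds 1 1 A A := fun x => by simp

theorem trans (h : SpectralBounds a b A B) (h' : SpectralBounds a' b' B C) (ha : 0 ≤ a)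
    (hb' : 0 ≤ b') : SpectralBounds (a * a') (b' * b) A C := fun x => by
  rw [mul_assoc, mul_assoc]
  exact ⟨(h x).1.trans (mul_le_mul_of_nonneg_left (h' x).1 ha),
    (h' x).2.trans (mul_le_mul_of_nonneg_left (h x).2 hb')⟩

theorem transpose_mul_mul (h : SpectralBounds a b A B) (T : Matrix V W ℝ) :
    SpectralBounds a b (Tᵀ * A * T) (Tᵀ * B * T) := fun x => by
  simpa only [quadForm_transpose_mul_mul] using h (T *ᵥ x)

theorem submatrix (h : SpectralBounds a b A B) (e : W ≃ V) :
    SpectralBounds a b (A.submatrix e e) (B.submatrix e e) := fun x => by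
  simpa only [quadForm_submatrix] using h (x ∘ e.symm)

end SpectralBounds

end QuadForm

/-! ## Spectral sparsification -/

section Sparsification

open Matrix

variable {V ι : Type*}

theorem sum_add_single_smul {E : Type*} [AddCommGroup E] [Module ℝ E] [Fintype ι] [DecidableEq ι]
    (s : ι → ℝ) (i : ι) (t : ℝ) (A : ι → E) :
    ∑ j, (s + Pi.single i t : ι → ℝ) j • A j = ∑ j, s j • A j + t • A i := by
  simp only [Pi.add_apply, add_smul, Finset.sum_add_distrib, Pi.single_apply, ite_smul, zero_smul,
    Finset.sum_ite_eq', Finset.mem_univ, if_true]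

theorem posDef_add_smul_vecMulVec [Finite V] {P : Matrix V V ℝ} (hP : P.PosDef) {t : ℝ}
    (ht : 0 ≤ t) (v : V → ℝ) : (P + t • vecMulVec v v).PosDef :=
  hP.add_posSemidef ((posSemidef_vecMulVec_self_star v).smul ht)

variable [Fintype V]

theorem trace_mul_nonneg {P Q : Matrix V V ℝ} (hP : P.PosSemidef) (hQ : Q.PosSemidef) :
    0 ≤ (P * Q).trace := by
  obtain ⟨B, rfl⟩ := exists_eq_transpose_mul_self hP
  rw [mul_assoc, trace_mul_comm]
  exact (hQ.mul_mul_conjTranspose_same B).trace_nonneg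

theorem trace_mul_pos [Nonempty V] {P Q : Matrix V V ℝ} (hP : P.PosDef) (hQ : Q.PosDef) :
    0 < (P * Q).trace := by
  classical
  obtain ⟨B, rfl⟩ := exists_eq_transpose_mul_self hP.posSemidef
  have hB := isUnit_det_of_isUnit_det_transpose_mul_self (isUnit_det_of_posDef hP)
  rw [mul_assoc, trace_mul_comm]
  exact (hQ.mul_mul_conjTranspose_same
    (vecMul_injective_iff_isUnit.2 ((isUnit_iff_isUnit_det B).2 hB))).trace_pos

theorem trace_mul_sq_le {N P : Matrix V V ℝ} (hN : N.IsSymm) (hP : P.PosSemidef) :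
    (N * P).trace ^ 2 ≤ P.trace * (N * P * N).trace := by
  classical
  refine sq_le_mul_of_forall_quadratic_nonneg fun t => ?_
  have h := (hP.mul_mul_conjTranspose_same (N + t • 1)).trace_nonneg
  rw [conjTranspose_eq_transpose_of_trivial, (hN.add (isSymm_one.smul t)).eq] at h
  have hexpand : (N + t • 1) * P * (N + t • 1) =
      N * P * N + t • (N * P) + t • (P * N) + t ^ 2 • P := by
    simp only [add_mul, mul_add, smul_mul_assoc, mul_smul_comm, mul_one, one_mul, smul_add]
    module
  rw [hexpand] at h
  simp only [trace_add, trace_smul, smul_eq_mul, trace_mul_comm P N] at h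
  linarith

theorem quadForm_le_trace_mul {Q : Matrix V V ℝ} (hQ : Q.PosSemidef) (x : V → ℝ) :
    quadForm Q x ≤ Q.trace * (x ⬝ᵥ x) := by
  classical
  have hpsd : ((x ⬝ᵥ x) • 1 - vecMulVec x x).PosSemidef :=
    posSemidef_of_quadForm_nonneg ((isSymm_one.smul _).sub (vecMulVec_self_isSymm x)) fun y => by
      have hcs := dotProduct_mulVec_sq_le PosSemidef.one x y
      rw [one_mulVec, quadForm_one, quadForm_one] at hcs
      rw [quadForm_sub, quadForm_smul, quadForm_one, quadForm_vecMulVec_self]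
      linarith
  have h := trace_mul_nonneg hQ hpsd
  rw [mul_sub, mul_smul_comm, mul_one, trace_sub, trace_smul, mul_vecMulVec, trace_vecMulVec,
    dotProduct_comm (Q *ᵥ x) x, smul_eq_mul, mul_comm] at h
  exact sub_nonneg.1 h

variable [DecidableEq V]

theorem posDef_sub_smul_vecMulVec {P : Matrix V V ℝ} (hP : P.PosDef) {t : ℝ} (ht : 0 ≤ t)
    {v : V → ℝ} (h : t * quadForm P⁻¹ v < 1) : (P - t • vecMulVec v v).PosDef := by
  refine posDef_of_quadForm_pos ((isSymm_of_posSemidef hP.posSemidef).sub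
    ((vecMulVec_self_isSymm v).smul t)) fun x hx => ?_
  have hpos := quadForm_pos hP hx
  have hcs := mul_le_mul_of_nonneg_left (dotProduct_sq_le_quadForm_inv_mul hP v x) ht
  rw [quadForm_sub, quadForm_smul, quadForm_vecMulVec_self]
  nlinarith

theorem posDef_sub_one {P : Matrix V V ℝ} (hP : P.PosDef) (h : P⁻¹.trace < 1) :
    (P - 1).PosDef := by
  refine posDef_of_quadForm_pos ((isSymm_of_posSemidef hP.posSemidef).sub isSymm_one)
    fun x hx => ?_
  have hpos := quadForm_pos hP hx
  have hx0 : 0 < x ⬝ᵥ x := quadForm_one x ▸ quadForm_pos PosDef.one hx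
  have hcs : (x ⬝ᵥ x) * (x ⬝ᵥ x) ≤ P⁻¹.trace * quadForm P x * (x ⬝ᵥ x) :=
    calc (x ⬝ᵥ x) * (x ⬝ᵥ x) ≤ quadForm P⁻¹ x * quadForm P x :=
          sq (x ⬝ᵥ x) ▸ dotProduct_sq_le_quadForm_inv_mul hP x x
      _ ≤ P⁻¹.trace * (x ⬝ᵥ x) * quadForm P x :=
          mul_le_mul_of_nonneg_right (quadForm_le_trace_mul hP.inv.posSemidef x) hpos.le
      _ = P⁻¹.trace * quadForm P x * (x ⬝ᵥ x) := by ring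
  rw [quadForm_sub, quadForm_one, sub_pos]
  calc x ⬝ᵥ x ≤ P⁻¹.trace * quadForm P x := le_of_mul_le_mul_right hcs hx0
    _ < quadForm P x := mul_lt_of_lt_one_left hpos h

theorem inv_add_smul_vecMulVec {P : Matrix V V ℝ} (hP : P.PosDef) {c : ℝ} {v : V → ℝ}
    (h : 1 + c * quadForm P⁻¹ v ≠ 0) :
    (P + c • vecMulVec v v)⁻¹ =
      P⁻¹ - (c / (1 + c * quadForm P⁻¹ v)) • vecMulVec (P⁻¹ *ᵥ v) (P⁻¹ *ᵥ v) := by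
  have hsymm : v ᵥ* P⁻¹ = P⁻¹ *ᵥ v := by
    rw [← mulVec_transpose, (isSymm_of_posSemidef hP.inv.posSemidef).eq]
  set d := 1 + c * quadForm P⁻¹ v with hd
  have hcoef : c - c / d - c * (c / d) * quadForm P⁻¹ v = 0 := by
    field_simp
    rw [hd]
    ring
  refine inv_eq_right_inv (sub_eq_zero.1 ?_)
  rw [add_mul, mul_sub, mul_sub, mul_nonsing_inv _ (isUnit_det_of_posDef hP), mul_smul_comm,
    mul_vecMulVec, mulVec_mulVec, mul_nonsing_inv _ (isUnit_det_of_posDef hP), one_mulVec,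
    smul_mul_assoc, vecMulVec_mul, hsymm, smul_mul_smul_comm, vecMulVec_mul_vecMulVec,
    vecMulVec_smul, ← quadForm]
  calc _ = (c - c / d - c * (c / d) * quadForm P⁻¹ v) • vecMulVec v (P⁻¹ *ᵥ v) := by module
    _ = 0 := by rw [hcoef, zero_smul]

theorem trace_inv_add_smul_vecMulVec {P : Matrix V V ℝ} (hP : P.PosDef) {c : ℝ} {v : V → ℝ}
    (h : 1 + c * quadForm P⁻¹ v ≠ 0) :
    (P + c • vecMulVec v v)⁻¹.trace =
      P⁻¹.trace - c * quadForm (P⁻¹ * P⁻¹) v / (1 + c * quadForm P⁻¹ v) := by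
  have hsq : (P⁻¹ *ᵥ v) ⬝ᵥ (P⁻¹ *ᵥ v) = quadForm (P⁻¹ * P⁻¹) v := by
    rw [quadForm, ← mulVec_mulVec, dotProduct_mulVec v, ← mulVec_transpose,
      (isSymm_of_posSemidef hP.inv.posSemidef).eq]
  rw [inv_add_smul_vecMulVec hP h, trace_sub, trace_smul, trace_vecMulVec, hsq, smul_eq_mul,
    div_mul_eq_mul_div]

theorem trace_inv_sub_inv_smul_vecMulVec_le {P : Matrix V V ℝ} (hP : P.PosDef) {v : V → ℝ}
    {w g : ℝ} (hw : 0 < w) (hPw : quadForm P⁻¹ v < w) (hg : 0 < g)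
    (h : quadForm (P⁻¹ * P⁻¹) v / g + quadForm P⁻¹ v ≤ w) :
    (P - w⁻¹ • vecMulVec v v)⁻¹.trace ≤ P⁻¹.trace + g := by
  have hgap : 0 < w - quadForm P⁻¹ v := sub_pos.2 hPw
  have hden : 1 + -w⁻¹ * quadForm P⁻¹ v = (w - quadForm P⁻¹ v) / w := by field_simp; ring
  have hgain : quadForm (P⁻¹ * P⁻¹) v / (w - quadForm P⁻¹ v) ≤ g := by
    rw [div_le_iff₀ hgap, mul_comm, ← div_le_iff₀ hg]
    linarith
  rw [sub_eq_add_neg, ← neg_smul, trace_inv_add_smul_vecMulVec hP (by rw [hden]; positivity), hden]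
  have : -w⁻¹ * quadForm (P⁻¹ * P⁻¹) v / ((w - quadForm P⁻¹ v) / w) =
      -(quadForm (P⁻¹ * P⁻¹) v / (w - quadForm P⁻¹ v)) := by field_simp
  linarith

theorem trace_inv_add_inv_smul_vecMulVec_le {P : Matrix V V ℝ} (hP : P.PosDef) {v : V → ℝ}
    {w g : ℝ} (hw : 0 < w) (hg : 0 < g)
    (h : w ≤ quadForm (P⁻¹ * P⁻¹) v / g - quadForm P⁻¹ v) :
    (P + w⁻¹ • vecMulVec v v)⁻¹.trace ≤ P⁻¹.trace - g := by
  have hsum : 0 < w + quadForm P⁻¹ v :=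
    add_pos_of_pos_of_nonneg hw (quadForm_nonneg hP.inv.posSemidef v)
  have hden : 1 + w⁻¹ * quadForm P⁻¹ v = (w + quadForm P⁻¹ v) / w := by field_simp
  have hgain : g ≤ quadForm (P⁻¹ * P⁻¹) v / (w + quadForm P⁻¹ v) := by
    rw [le_div_iff₀ hsum, mul_comm, ← le_div_iff₀ hg]
    linarith
  rw [trace_inv_add_smul_vecMulVec hP (by rw [hden]; positivity), hden]
  have : w⁻¹ * quadForm (P⁻¹ * P⁻¹) v / ((w + quadForm P⁻¹ v) / w) =
      quadForm (P⁻¹ * P⁻¹) v / (w + quadForm P⁻¹ v) := by field_simp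
  linarith

theorem trace_inv_sub_trace_inv_add_smul_one_ge {P : Matrix V V ℝ} (hP : P.PosDef) {δ : ℝ}
    (hδ : 0 < δ) :
    δ * ((P + δ • 1)⁻¹ * (P + δ • 1)⁻¹).trace ≤ P⁻¹.trace - (P + δ • 1)⁻¹.trace := by
  have hPδ : (P + δ • 1).PosDef := hP.add (PosDef.one.smul hδ)
  have hresolvent : P⁻¹ - (P + δ • 1)⁻¹ = δ • (P⁻¹ * (P + δ • 1)⁻¹) := by
    rw [inv_sub_inv (iff_of_true hP.isUnit hPδ.isUnit)]
    simp
  set N := P⁻¹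
  set R := (P + δ • 1)⁻¹
  have hNRR : 0 ≤ (N * (R * R)).trace :=
    trace_mul_nonneg hP.inv.posSemidef (sq R ▸ hPδ.inv.posSemidef.pow 2)
  have hsplit : N * R = R * R + δ • (N * (R * R)) := by
    rw [← sub_eq_iff_eq_add', ← sub_mul, hresolvent, smul_mul_assoc, mul_assoc]
  rw [← trace_sub, hresolvent, trace_smul, smul_eq_mul]
  refine mul_le_mul_of_nonneg_left ?_ hδ.le
  rw [hsplit, trace_add, trace_smul, smul_eq_mul]
  exact le_add_of_nonneg_right (mul_nonneg hδ.le hNRR)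

/-- The left side is the trace of the cost of a rank-one update at the shifted upper barrier. -/
theorem upperBarrier_cost_lt [Nonempty V] {P : Matrix V V ℝ} (hP : P.PosDef) {δ g : ℝ}
    (hδ : 0 < δ) (hg : g = P⁻¹.trace - (P + δ • 1)⁻¹.trace) :
    0 < g ∧ ((P + δ • 1)⁻¹ * (P + δ • 1)⁻¹).trace / g + (P + δ • 1)⁻¹.trace <
      1 / δ + P⁻¹.trace := by
  have hPδ := (hP.add (PosDef.one.smul hδ)).inv
  have hle := hg ▸ trace_inv_sub_trace_inv_add_smul_one_ge hP hδ
  have hg0 : 0 < g := (mul_pos hδ (trace_mul_pos hPδ hPδ)).trans_le hle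
  have hdiv : ((P + δ • 1)⁻¹ * (P + δ • 1)⁻¹).trace / g ≤ 1 / δ := by
    rw [div_le_div_iff₀ hg0 hδ]
    linarith
  exact ⟨hg0, by linarith⟩

/-- The right side is the trace of the gain of a rank-one update at the shifted lower barrier. -/
theorem le_lowerBarrier_gain [Nonempty V] {P : Matrix V V ℝ} (hP : P.PosDef)
    (hP' : (P - 1).PosDef) (htrace : P⁻¹.trace ≤ 1) {g : ℝ}
    (hg : g = (P - 1)⁻¹.trace - P⁻¹.trace) :
    0 < g ∧ 1 - P⁻¹.trace ≤ ((P - 1)⁻¹ * (P - 1)⁻¹).trace / g - (P - 1)⁻¹.trace := by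
  have hresolvent : (P - 1)⁻¹ - P⁻¹ = (P - 1)⁻¹ * P⁻¹ := by
    rw [inv_sub_inv (iff_of_true hP'.isUnit hP.isUnit), sub_sub_cancel, mul_one]
  have hgRN : g = ((P - 1)⁻¹ * P⁻¹).trace := by rw [hg, ← trace_sub, hresolvent]
  have hg0 : 0 < g := hgRN ▸ trace_mul_pos hP'.inv hP.inv
  set N := P⁻¹
  set R := (P - 1)⁻¹
  have hR : R.IsSymm := isSymm_of_posSemidef hP'.inv.posSemidef
  have hRNR : 0 ≤ (R * N * R).trace := by
    have h := hP.inv.posSemidef.mul_mul_conjTranspose_same R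
    rw [conjTranspose_eq_transpose_of_trivial, hR.eq] at h
    exact h.trace_nonneg
  have hsq : g ^ 2 ≤ (R * N * R).trace :=
    hgRN ▸ (trace_mul_sq_le hR hP.inv.posSemidef).trans (mul_le_of_le_one_left hRNR htrace)
  have hsplit : (R * R).trace = g + (R * N * R).trace := by
    rw [hgRN, trace_mul_comm R N, ← sub_eq_iff_eq_add', ← trace_sub, ← sub_mul, hresolvent]
  have hdiv : 1 + g ≤ (R * R).trace / g := by
    rw [le_div_iff₀ hg0]
    linarith
  exact ⟨hg0, by linarith⟩

/-- The state of the barrier argument of Batson, Spielman and Srivastava: the eigenvalues of `A` lie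
strictly between `l` and `u`, and both barrier potentials are at most `η`. -/
structure Barrier (η l u : ℝ) (A : Matrix V V ℝ) : Prop where
  upper : (u • 1 - A).PosDef
  lower : (A - l • 1).PosDef
  upper_trace : (u • 1 - A)⁻¹.trace ≤ η
  lower_trace : (A - l • 1)⁻¹.trace ≤ η

theorem sum_quadForm_eq_trace [Fintype ι] {v : ι → V → ℝ} (hv : ∑ i, vecMulVec (v i) (v i) = 1)
    (N : Matrix V V ℝ) : ∑ i, quadForm N (v i) = N.trace :=
  calc ∑ i, quadForm N (v i) = ∑ i, (N * vecMulVec (v i) (v i)).trace :=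
        Finset.sum_congr rfl fun i _ => by
          rw [mul_vecMulVec, trace_vecMulVec, dotProduct_comm, quadForm]
    _ = N.trace := by rw [← trace_sum, ← Finset.mul_sum, hv, mul_one]

theorem exists_quadForm_add_lt_sub [Fintype ι] {v : ι → V → ℝ}
    (hv : ∑ i, vecMulVec (v i) (v i) = 1) {Q R : Matrix V V ℝ} {g g' : ℝ}
    (h : (Q * Q).trace / g + Q.trace < (R * R).trace / g' - R.trace) :
    ∃ i, quadForm (Q * Q) (v i) / g + quadForm Q (v i) <
      quadForm (R * R) (v i) / g' - quadForm R (v i) := by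
  simp only [← sum_quadForm_eq_trace hv, Finset.sum_div, ← Finset.sum_add_distrib,
    ← Finset.sum_sub_distrib] at h
  obtain ⟨i, -, hi⟩ := Finset.exists_lt_of_sum_lt h
  exact ⟨i, hi⟩

theorem Barrier.exists_add_smul_vecMulVec [Nonempty V] [Fintype ι] {v : ι → V → ℝ}
    (hv : ∑ i, vecMulVec (v i) (v i) = 1) {η l u : ℝ} {A : Matrix V V ℝ} (hη : η < 1 / 2)
    (hA : Barrier η l u A) :
    ∃ (i : ι) (t : ℝ), 0 ≤ t ∧
      Barrier η (l + 1) (u + 1 / (1 - 2 * η)) (A + t • vecMulVec (v i) (v i)) := by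
  have hlt : 0 < 1 - 2 * η := by linarith
  set δ := 1 / (1 - 2 * η)
  have hδ0 : 0 < δ := one_div_pos.2 hlt
  have htrace : (A - l • 1)⁻¹.trace < 1 := hA.lower_trace.trans_lt (by linarith)
  have hP := hA.upper.add (PosDef.one.smul hδ0)
  have hL := posDef_sub_one hA.lower htrace
  obtain ⟨hgU, hcost⟩ := upperBarrier_cost_lt hA.upper hδ0 rfl
  obtain ⟨hgL, hgain⟩ := le_lowerBarrier_gain hA.lower hL htrace.le rfl
  have hδη : 1 / δ = 1 - 2 * η := one_div_one_div _
  obtain ⟨i, hi⟩ := exists_quadForm_add_lt_sub hv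
    (hcost.trans_le (hgain.trans' (by linarith [hA.upper_trace, hA.lower_trace])))
  set gL := (A - l • 1 - 1)⁻¹.trace - (A - l • 1)⁻¹.trace
  set w := quadForm ((A - l • 1 - 1)⁻¹ * (A - l • 1 - 1)⁻¹) (v i) / gL -
    quadForm (A - l • 1 - 1)⁻¹ (v i)
  have hQw : quadForm (u • 1 - A + δ • 1)⁻¹ (v i) < w := by
    have hQQ := quadForm_nonneg (sq (u • 1 - A + δ • 1)⁻¹ ▸ hP.inv.posSemidef.pow 2) (v i)
    exact (le_add_of_nonneg_left (div_nonneg hQQ hgU.le)).trans_lt hi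
  have hw : 0 < w := (quadForm_nonneg hP.inv.posSemidef _).trans_lt hQw
  have eU : (u + δ) • 1 - (A + w⁻¹ • vecMulVec (v i) (v i)) =
      u • 1 - A + δ • 1 - w⁻¹ • vecMulVec (v i) (v i) := by module
  have eL : A + w⁻¹ • vecMulVec (v i) (v i) - (l + 1) • 1 =
      A - l • 1 - 1 + w⁻¹ • vecMulVec (v i) (v i) := by module
  refine ⟨i, w⁻¹, by positivity, eU ▸ ?_, eL ▸ ?_, eU ▸ ?_, eL ▸ ?_⟩
  · exact posDef_sub_smul_vecMulVec hP (by positivity) ((inv_mul_lt_one₀ hw).2 hQw)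
  · exact posDef_add_smul_vecMulVec hL (by positivity) _
  · linarith [trace_inv_sub_inv_smul_vecMulVec_le hP hw hQw hgU hi.le, hA.upper_trace]
  · linarith [trace_inv_add_inv_smul_vecMulVec_le hL hw hgL le_rfl, hA.lower_trace]

theorem Barrier.zero [Nonempty V] {η : ℝ} (hη : 0 < η) :
    Barrier η (-(Fintype.card V / η)) (Fintype.card V / η) (0 : Matrix V V ℝ) := by
  have hcard : (0 : ℝ) < Fintype.card V := mod_cast Fintype.card_pos
  have hc : (0 : ℝ) < Fintype.card V / η := by positivity
  have hpos : ((Fintype.card V / η : ℝ) • (1 : Matrix V V ℝ)).PosDef := PosDef.one.smul hc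
  have htrace : ((Fintype.card V / η : ℝ) • (1 : Matrix V V ℝ))⁻¹.trace ≤ η := by
    have hinv : ((Fintype.card V / η : ℝ) • (1 : Matrix V V ℝ))⁻¹ = (Fintype.card V / η)⁻¹ • 1 :=
      inv_eq_right_inv (by rw [smul_mul_smul_comm, mul_one, mul_inv_cancel₀ hc.ne', one_smul])
    rw [hinv, trace_smul, trace_one, smul_eq_mul, inv_div, div_mul_cancel₀ _ hcard.ne']
  constructor <;> simpa

theorem exists_barrier [Nonempty V] [Fintype ι] {v : ι → V → ℝ}
    (hv : ∑ i, vecMulVec (v i) (v i) = 1) {η : ℝ} (hη₀ : 0 < η) (hη : η < 1 / 2) (m : ℕ) :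
    ∃ s : ι → ℝ, 0 ≤ s ∧ (Function.support s).ncard ≤ m ∧
      Barrier η (-(Fintype.card V / η) + m) (Fintype.card V / η + m * (1 / (1 - 2 * η)))
        (∑ i, s i • vecMulVec (v i) (v i)) := by
  classical
  induction m with
  | zero => exact ⟨0, le_rfl, by simp, by simpa using Barrier.zero hη₀⟩
  | succ m ih =>
    obtain ⟨s, hs0, hsm, hs⟩ := ih
    obtain ⟨i, t, ht, h⟩ := hs.exists_add_smul_vecMulVec hv hη
    refine ⟨s + Pi.single i t, add_nonneg hs0 (Pi.single_nonneg.2 ht), ?_, ?_⟩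
    · calc (Function.support (s + Pi.single i t)).ncard
          ≤ (Function.support s ∪ {i}).ncard :=
            Set.ncard_le_ncard ((Function.support_add _ _).trans
              (Set.union_subset_union_right _ Pi.support_single_subset)) (Set.toFinite _)
        _ ≤ m + 1 := (Set.ncard_union_le _ _).trans
            (add_le_add hsm (Set.ncard_singleton i).le)
    · rw [sum_add_single_smul]
      convert h using 1 <;> push_cast <;> ring

theorem one_add_sq_div_sub_two_le {q : ℝ} (hq : 4 ≤ q) :
    1 + q ^ 2 / (q - 2) ≤ (1 + 10 / q) * (q - 1) := by
  have hq2 : 0 < q - 2 := by linarith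
  have hl : 1 + q ^ 2 / (q - 2) = (q - 2 + q ^ 2) / (q - 2) := by field_simp
  have hr : (1 + 10 / q) * (q - 1) = (q + 10) * (q - 1) / q := by field_simp
  rw [hl, hr, div_le_div_iff₀ hq2 (by linarith)]
  nlinarith

theorem Barrier.spectralBounds {η l u c : ℝ} {A : Matrix V V ℝ} (h : Barrier η l u A) (hl : 0 < l)
    (hu : u ≤ c * l) : SpectralBounds c 1 (l⁻¹ • A) 1 := fun x => by
  have hlower := quadForm_nonneg h.lower.posSemidef x
  have hupper := quadForm_nonneg h.upper.posSemidef x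
  rw [quadForm_sub, quadForm_smul] at hlower hupper
  have hx := mul_le_mul_of_nonneg_right hu (quadForm_nonneg PosSemidef.one x)
  rw [quadForm_smul, inv_mul_le_iff₀ hl, one_mul, le_inv_mul_iff₀ hl]
  exact ⟨by linarith, by linarith⟩

theorem exists_sparsifier_of_sum_eq_one [Fintype ι] {v : ι → V → ℝ}
    (hv : ∑ i, vecMulVec (v i) (v i) = 1) {q : ℕ} (hq : 4 ≤ q) :
    ∃ s : ι → ℝ, 0 ≤ s ∧ (Function.support s).ncard ≤ Fintype.card V * q ^ 2 ∧
      SpectralBounds (1 + 10 / q) 1 (∑ i, s i • vecMulVec (v i) (v i)) 1 := by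
  rcases isEmpty_or_nonempty V with hV | hV
  · exact ⟨0, le_rfl, by simp, fun x => by simp [Subsingleton.elim x 0]⟩
  have hq4 : (4 : ℝ) ≤ q := by exact_mod_cast hq
  have : (0 : ℝ) < Fintype.card V := mod_cast Fintype.card_pos
  have hq2 : (q : ℝ) - 2 ≠ 0 := by linarith
  obtain ⟨s, hs0, hsm, hs⟩ := exists_barrier hv (η := 1 / q) (by positivity)
    (one_div_lt_one_div_of_lt two_pos (by linarith)) (Fintype.card V * q ^ 2)
  set l : ℝ := -(Fintype.card V / (1 / q)) + (Fintype.card V * q ^ 2 : ℕ) with hl_def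
  have hl : l = Fintype.card V * q * (q - 1) := by
    rw [hl_def]
    push_cast
    field_simp
    ring
  have hu : Fintype.card V / (1 / q) + (Fintype.card V * q ^ 2 : ℕ) * (1 / (1 - 2 * (1 / q))) =
      Fintype.card V * q * (1 + q ^ 2 / (q - 2) : ℝ) := by
    rw [show 1 - 2 * (1 / (q : ℝ)) = (q - 2) / q by field_simp]
    push_cast
    field_simp
  have hl0 : 0 < l := hl ▸ mul_pos (by positivity) (by linarith)
  refine ⟨l⁻¹ • s, smul_nonneg (by positivity) hs0, ?_, ?_⟩
  · rwa [Function.support_const_smul_of_ne_zero _ _ (by positivity)]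
  · simp only [Pi.smul_apply, smul_assoc, ← Finset.smul_sum]
    refine hs.spectralBounds hl0 ?_
    rw [hu, hl, mul_left_comm]
    exact mul_le_mul_of_nonneg_left (one_add_sq_div_sub_two_le hq4) (by positivity)

omit [DecidableEq V] in
theorem exists_sparsifier [Fintype ι] {M : Matrix V V ℝ} (hM : M.PosDef) {v : ι → V → ℝ}
    (hv : ∑ i, vecMulVec (v i) (v i) = M) {q : ℕ} (hq : 4 ≤ q) :
    ∃ s : ι → ℝ, 0 ≤ s ∧ (Function.support s).ncard ≤ Fintype.card V * q ^ 2 ∧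
      SpectralBounds (1 + 10 / q) 1 (∑ i, s i • vecMulVec (v i) (v i)) M := by
  classical
  obtain ⟨B, hB⟩ := exists_eq_transpose_mul_self hM.posSemidef
  have hdet : IsUnit B.det :=
    isUnit_det_of_isUnit_det_transpose_mul_self (hB ▸ isUnit_det_of_posDef hM)
  have hw : ∑ i, vecMulVec (v i ᵥ* B⁻¹) (v i ᵥ* B⁻¹) = 1 := by
    simp only [← transpose_mul_vecMulVec_self_mul]
    rw [← Finset.sum_mul, ← Finset.mul_sum, hv, hB, mul_assoc, mul_assoc, mul_nonsing_inv _ hdet,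
      mul_one, ← transpose_mul, mul_nonsing_inv _ hdet, transpose_one]
  obtain ⟨s, hs0, hsm, hs⟩ := exists_sparsifier_of_sum_eq_one hw hq
  refine ⟨s, hs0, hsm, ?_⟩
  have hsum : Bᵀ * (∑ i, s i • vecMulVec (v i ᵥ* B⁻¹) (v i ᵥ* B⁻¹)) * B =
      ∑ i, s i • vecMulVec (v i) (v i) := by
    simp only [Finset.mul_sum, Finset.sum_mul, mul_smul_comm, smul_mul_assoc,
      transpose_mul_vecMulVec_self_mul, vecMul_vecMul, nonsing_inv_mul _ hdet, vecMul_one]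
  have h := hs.transpose_mul_mul B
  rwa [hsum, mul_one, ← hB] at h

omit [DecidableEq V] in
theorem exists_weighted_sparsifier [Fintype ι] {M : Matrix V V ℝ} (hM : M.PosDef) {w : ι → ℝ}
    (hw : 0 ≤ w) {v : ι → V → ℝ} (hv : ∑ i, w i • vecMulVec (v i) (v i) = M) {q : ℕ}
    (hq : 4 ≤ q) :
    ∃ s : ι → ℝ, 0 ≤ s ∧ (Function.support s).ncard ≤ Fintype.card V * q ^ 2 ∧
      SpectralBounds (1 + 10 / q) 1 (∑ i, s i • vecMulVec (v i) (v i)) M := by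
  have hscale : ∀ i, vecMulVec (√(w i) • v i) (√(w i) • v i) = w i • vecMulVec (v i) (v i) := by
    intro i
    rw [smul_vecMulVec, vecMulVec_smul, smul_smul, Real.mul_self_sqrt (hw i)]
  obtain ⟨s, hs0, hcard, hs⟩ :=
    exists_sparsifier hM ((Finset.sum_congr rfl fun i _ => hscale i).trans hv) hq
  refine ⟨s * w, mul_nonneg hs0 hw, le_trans (Set.ncard_le_ncard ?_ (Set.toFinite _)) hcard, ?_⟩
  · exact Function.support_mul_subset_left s w
  · simpa only [hscale, smul_smul, Pi.mul_apply] using hs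

end Sparsification

/-! ## Diagonally dominant matrices and weighted graphs -/

section Support

open Matrix

variable {V W : Type*} [Fintype W]

open scoped Classical in
/-- The column indices of the nonzero entries of row `i`. -/
noncomputable def rowSupport (A : Matrix V W ℝ) (i : V) : Finset W :=
  {j | A i j ≠ 0}

theorem mem_rowSupport {A : Matrix V W ℝ} {i : V} {j : W} : j ∈ rowSupport A i ↔ A i j ≠ 0 := by
  simp [rowSupport]

variable [Fintype V]

open scoped Classical in
/-- The column indices of the nonzero entries of row `i` off the diagonal: the neighbours of `i` in
the graph of `A`. -/
noncomputable def offDiagSupport (A : Matrix V V ℝ) (i : V) : Finset V :=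
  {j | j ≠ i ∧ A i j ≠ 0}

/-- The number of nonzero entries off the diagonal. -/
noncomputable def numOffDiag (A : Matrix V V ℝ) : ℕ :=
  ∑ i, (offDiagSupport A i).card

theorem mem_offDiagSupport {A : Matrix V V ℝ} {i j : V} :
    j ∈ offDiagSupport A i ↔ j ≠ i ∧ A i j ≠ 0 := by
  simp [offDiagSupport]

theorem card_offDiagSupport_submatrix (A : Matrix V V ℝ) (e : W ≃ V) (i : W) :
    (offDiagSupport (A.submatrix e e) i).card = (offDiagSupport A (e i)).card :=
  Finset.card_equiv e fun j => by simp [mem_offDiagSupport]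

theorem numOffDiag_submatrix (A : Matrix V V ℝ) (e : W ≃ V) :
    numOffDiag (A.submatrix e e) = numOffDiag A := by
  simp only [numOffDiag, card_offDiagSupport_submatrix]
  exact e.sum_comp fun i => (offDiagSupport A i).card

theorem card_offDiagSupport_fromBlocks_inl (A : Matrix V V ℝ) (B : Matrix V W ℝ)
    (C : Matrix W V ℝ) (D : Matrix W W ℝ) (i : V) :
    (offDiagSupport (fromBlocks A B C D) (.inl i)).card =
      (offDiagSupport A i).card + (rowSupport B i).card := by
  classical
  simp only [offDiagSupport, rowSupport, Finset.card_filter, Fintype.sum_sum_type]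
  simp [-Finset.sum_boole]

theorem card_offDiagSupport_fromBlocks_inr (A : Matrix V V ℝ) (B : Matrix V W ℝ)
    (C : Matrix W V ℝ) (D : Matrix W W ℝ) (i : W) :
    (offDiagSupport (fromBlocks A B C D) (.inr i)).card =
      (rowSupport C i).card + (offDiagSupport D i).card := by
  classical
  simp only [offDiagSupport, rowSupport, Finset.card_filter, Fintype.sum_sum_type]
  simp [-Finset.sum_boole]

theorem numOffDiag_eq_card (A : Matrix V V ℝ)
    [DecidablePred fun p : V × V => p.2 ≠ p.1 ∧ A p.1 p.2 ≠ 0] :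
    numOffDiag A = ({p | p.2 ≠ p.1 ∧ A p.1 p.2 ≠ 0} : Finset (V × V)).card := by
  classical
  simp only [numOffDiag, offDiagSupport, Finset.card_filter, Fintype.sum_prod_type]
  congr! 3

theorem numOffDiag_transpose (A : Matrix V V ℝ) : numOffDiag Aᵀ = numOffDiag A := by
  classical
  rw [numOffDiag_eq_card, numOffDiag_eq_card]
  exact Finset.card_equiv (Equiv.prodComm V V) fun p => by simp [ne_comm]

theorem numNonzero_le_add_numOffDiag {n : ℕ} (A : Matrix (Fin n) (Fin n) ℝ) :
    numNonzero A ≤ n + numOffDiag A := by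
  classical
  have hsub : ({p | A p.1 p.2 ≠ 0} : Finset (Fin n × Fin n)) ⊆
      Finset.univ.diag ∪ ({p | p.2 ≠ p.1 ∧ A p.1 p.2 ≠ 0} : Finset (Fin n × Fin n)) := by
    intro p hp
    by_cases h : p.1 = p.2
    · simp [h]
    · simpa [h, Ne.symm h] using hp
  calc numNonzero A = ({p | A p.1 p.2 ≠ 0} : Finset (Fin n × Fin n)).card := by
        rw [numNonzero, ← Set.ncard_coe_finset]
        simp
    _ ≤ (Finset.univ : Finset (Fin n)).diag.card + numOffDiag A := by
        rw [numOffDiag_eq_card]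
        exact (Finset.card_le_card hsub).trans (Finset.card_union_le _ _)
    _ = n + numOffDiag A := by simp

end Support

section DiagonallyDominant

open Matrix

variable {V W : Type*}

/-- The weight `-M i j` of the edge between `i` and `j ≠ i` in the graph of which `M` is, up to a
diagonal matrix, the Laplacian. -/
def edgeWeight [DecidableEq V] (M : Matrix V V ℝ) (i j : V) : ℝ :=
  if i = j then 0 else -M i j

/-- The vector of row sums. -/
def rowSum [Fintype W] (M : Matrix V W ℝ) (i : V) : ℝ :=
  ∑ j, M i j

theorem rowSum_eq_mulVec_one [Fintype W] (M : Matrix V W ℝ) : rowSum M = M *ᵥ 1 := by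
  funext i
  simp [rowSum, mulVec, dotProduct]

section EdgeWeight

variable [DecidableEq V]

@[simp]
theorem edgeWeight_self (M : Matrix V V ℝ) (i : V) : edgeWeight M i i = 0 := if_pos rfl

theorem edgeWeight_of_ne (M : Matrix V V ℝ) {i j : V} (h : i ≠ j) : edgeWeight M i j = -M i j :=
  if_neg h

theorem edgeWeight_comm {M : Matrix V V ℝ} (hM : M.IsSymm) (i j : V) :
    edgeWeight M i j = edgeWeight M j i := by
  simp only [edgeWeight, eq_comm (a := i), hM.apply i j]

theorem edgeWeight_submatrix [DecidableEq W] (M : Matrix V V ℝ) {f : W → V}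
    (hf : Function.Injective f) (i j : W) :
    edgeWeight (M.submatrix f f) i j = edgeWeight M (f i) (f j) := by
  simp only [edgeWeight, hf.eq_iff, submatrix_apply]

theorem rowSum_add_sum_edgeWeight [Fintype V] (M : Matrix V V ℝ) (i : V) :
    rowSum M i + ∑ j, edgeWeight M i j = M i i := by
  rw [rowSum, ← Finset.sum_add_distrib, Finset.sum_eq_single i]
  · simp
  · intro j _ hj
    simp [edgeWeight_of_ne M hj.symm]
  · simp

end EdgeWeight

theorem matrix_eq_of_rowSum_eq [Fintype V] {A B : Matrix V V ℝ}
    (hoff : ∀ i j, i ≠ j → A i j = B i j) (hrow : ∀ i, rowSum A i = rowSum B i) : A = B := by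
  classical
  ext i j
  by_cases h : i = j
  · have hweight : edgeWeight A i = edgeWeight B i := by
      funext k
      by_cases hk : i = k
      · simp [edgeWeight, hk]
      · rw [edgeWeight_of_ne A hk, edgeWeight_of_ne B hk, hoff i k hk]
    rw [← h, ← rowSum_add_sum_edgeWeight A i, ← rowSum_add_sum_edgeWeight B i, hrow, hweight]
  · exact hoff i j h

variable [DecidableEq V]

/-- The vectors `e i - e j` and `e i`, whose rank-one matrices are the Laplacian of the edge `i j`
and a unit of excess diagonal at the vertex `i`. -/
def edgeVector : (V × V) ⊕ V → V → ℝ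
  | .inl p => Pi.single p.1 1 - Pi.single p.2 1
  | .inr i => Pi.single i 1

variable [Fintype V]

/-- The weighted sum of the rank-one matrices of edges and vertices. -/
def graphMatrix (w : (V × V) ⊕ V → ℝ) : Matrix V V ℝ :=
  ∑ e, w e • vecMulVec (edgeVector e) (edgeVector e)

theorem graphMatrix_isSymm (w : (V × V) ⊕ V → ℝ) : (graphMatrix w).IsSymm := by
  rw [IsSymm, graphMatrix, transpose_sum]
  exact Finset.sum_congr rfl fun e _ => (vecMulVec_self_isSymm _).smul _

theorem graphMatrix_apply_of_ne (w : (V × V) ⊕ V → ℝ) {i j : V} (h : i ≠ j) :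
    graphMatrix w i j = -(w (.inl (i, j)) + w (.inl (j, i))) := by
  have hterm : ∀ a b : V, w (.inl (a, b)) *
      (((Pi.single a 1 - Pi.single b 1 : V → ℝ) i) * (Pi.single a 1 - Pi.single b 1 : V → ℝ) j) =
      (if a = j then (if b = i then -w (.inl (a, b)) else 0) else 0) +
        (if a = i then (if b = j then -w (.inl (a, b)) else 0) else 0) := by
    intro a b
    simp only [Pi.sub_apply, Pi.single_apply]
    grind
  simp only [graphMatrix, Matrix.sum_apply, Matrix.smul_apply, vecMulVec_apply, smul_eq_mul,
    Fintype.sum_sum_type, Fintype.sum_prod_type, edgeVector, hterm, Finset.sum_add_distrib]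
  have hvertex : ∀ a : V, (Pi.single a 1 : V → ℝ) i * (Pi.single a 1 : V → ℝ) j = 0 := by
    intro a
    simp only [Pi.single_apply]
    grind
  simp [hvertex]

theorem rowSum_graphMatrix (w : (V × V) ⊕ V → ℝ) (i : V) :
    rowSum (graphMatrix w) i = w (.inr i) := by
  have hzero : ∀ p : V × V, ∑ j, edgeVector (.inl p) j = 0 := fun p => by
    simp [edgeVector, Finset.sum_sub_distrib]
  simp only [rowSum, graphMatrix, Matrix.sum_apply, Matrix.smul_apply, vecMulVec_apply, smul_eq_mul]
  rw [Finset.sum_comm]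
  simp only [← Finset.mul_sum, Fintype.sum_sum_type, hzero]
  simp [edgeVector, Pi.single_apply]

theorem numOffDiag_graphMatrix_le (w : (V × V) ⊕ V → ℝ) :
    numOffDiag (graphMatrix w) ≤ 2 * (Function.support w).ncard := by
  classical
  set E : Finset (V × V) := {p | w (.inl p) ≠ 0}
  have hE : E.card ≤ (Function.support w).ncard := by
    rw [← Finset.card_map .inl, ← Set.ncard_coe_finset]
    refine Set.ncard_le_ncard (fun e he => ?_) (Set.toFinite _)
    obtain ⟨p, hp, rfl⟩ := Finset.mem_map.1 he
    exact (Finset.mem_filter.1 hp).2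
  have hsub : ({p | p.2 ≠ p.1 ∧ graphMatrix w p.1 p.2 ≠ 0} : Finset (V × V)) ⊆
      E ∪ E.map (Equiv.prodComm V V).toEmbedding := by
    rintro ⟨i, j⟩ hij
    obtain ⟨hne, h⟩ := (Finset.mem_filter.1 hij).2
    rw [graphMatrix_apply_of_ne w hne.symm] at h
    simp only [E, Finset.mem_union, Finset.mem_filter, Finset.mem_univ, true_and,
      Finset.mem_map_equiv, Equiv.prodComm_symm, Equiv.prodComm_apply, Prod.swap_prod_mk]
    by_contra! h0
    simp [h0.1, h0.2] at h
  calc numOffDiag (graphMatrix w) ≤ E.card + (E.map (Equiv.prodComm V V).toEmbedding).card := by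
        rw [numOffDiag_eq_card]
        exact (Finset.card_le_card hsub).trans (Finset.card_union_le _ _)
    _ ≤ 2 * (Function.support w).ncard := by
        rw [Finset.card_map]
        omega

/-- The edge and vertex weights for which `graphMatrix` gives back `M`; every edge is listed in both
directions. -/
noncomputable def graphWeight (M : Matrix V V ℝ) : (V × V) ⊕ V → ℝ :=
  Sum.elim (fun p => edgeWeight M p.1 p.2 / 2) (rowSum M)

theorem graphMatrix_graphWeight {M : Matrix V V ℝ} (hM : M.IsSymm) :
    graphMatrix (graphWeight M) = M := by
  refine matrix_eq_of_rowSum_eq (fun i j h => ?_) (rowSum_graphMatrix _)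
  rw [graphMatrix_apply_of_ne _ h]
  simp only [graphWeight, Sum.elim_inl, edgeWeight_comm hM j i, edgeWeight_of_ne M h]
  ring

theorem quadForm_eq_sum_edges {M : Matrix V V ℝ} (hM : M.IsSymm) (x : V → ℝ) :
    quadForm M x = (∑ i, ∑ j, edgeWeight M i j * (x i - x j) ^ 2) / 2 +
      quadForm (diagonal (rowSum M)) x := by
  have hsum : ∀ w : (V × V) ⊕ V → ℝ,
      quadForm (graphMatrix w) x = ∑ e, w e * (edgeVector e ⬝ᵥ x) ^ 2 := fun w => by
    simp only [← quadForm_vecMulVec_self, ← quadForm_smul]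
    simp only [graphMatrix, quadForm, sum_mulVec, dotProduct_sum]
  conv_lhs => rw [← graphMatrix_graphWeight hM, hsum]
  simp only [Fintype.sum_sum_type, Fintype.sum_prod_type, graphWeight, Sum.elim_inl, Sum.elim_inr,
    edgeVector, sub_dotProduct, single_dotProduct, one_mul, quadForm_diagonal, Finset.sum_div,
    div_mul_eq_mul_div]

theorem quadForm_nonneg_of_edgeWeight_nonneg {M : Matrix V V ℝ} (hM : M.IsSymm)
    (hw : ∀ i j, 0 ≤ edgeWeight M i j) (hrow : 0 ≤ rowSum M) (x : V → ℝ) : 0 ≤ quadForm M x := by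
  rw [quadForm_eq_sum_edges hM, quadForm_diagonal]
  have hedges : 0 ≤ ∑ i, ∑ j, edgeWeight M i j * (x i - x j) ^ 2 :=
    Finset.sum_nonneg fun i _ => Finset.sum_nonneg fun j _ => mul_nonneg (hw i j) (sq_nonneg _)
  have hdiag : 0 ≤ ∑ i, rowSum M i * x i ^ 2 :=
    Finset.sum_nonneg fun i _ => mul_nonneg (hrow i) (sq_nonneg _)
  positivity

omit [DecidableEq V] in
/-- SDDM matrices over an arbitrary finite index type, with nonsingularity in the form of positive
definiteness and diagonal dominance in the form of nonnegative row sums. -/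
structure IsSDDMOn (M : Matrix V V ℝ) : Prop where
  offDiag_nonpos : ∀ i j, i ≠ j → M i j ≤ 0
  rowSum_nonneg : 0 ≤ rowSum M
  posDef : M.PosDef

/-- SDDM matrices whose excess diagonal dominates the remaining part, which has quadratic form at
most `2 * ∑ j, edgeWeight A i j` on the vertices, up to the factor `θ`. -/
structure IsStronglyDominant (θ : ℝ) (A : Matrix V V ℝ) : Prop extends IsSDDMOn A where
  dominant : ∀ i, 2 * ∑ j, edgeWeight A i j ≤ θ * rowSum A i

namespace IsSDDMOn

variable {M : Matrix V V ℝ}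

omit [DecidableEq V] in
theorem isSymm (hM : IsSDDMOn M) : M.IsSymm :=
  isSymm_of_posSemidef hM.posDef.posSemidef

theorem edgeWeight_nonneg (hM : IsSDDMOn M) (i j : V) : 0 ≤ edgeWeight M i j := by
  by_cases h : i = j
  · simp [h]
  · rw [edgeWeight_of_ne M h]
    exact neg_nonneg.2 (hM.offDiag_nonpos i j h)

theorem graphWeight_nonneg (hM : IsSDDMOn M) : 0 ≤ graphWeight M := by
  rintro (p | i)
  · exact div_nonneg (hM.edgeWeight_nonneg _ _) two_pos.le
  · exact hM.rowSum_nonneg i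

theorem sum_edgeWeight_le (hM : IsSDDMOn M) (i : V) : ∑ j, edgeWeight M i j ≤ M i i := by
  rw [← rowSum_add_sum_edgeWeight M i]
  exact le_add_of_nonneg_left (hM.rowSum_nonneg i)

omit [DecidableEq V] in
theorem submatrix_equiv [Fintype W] (hM : IsSDDMOn M) (e : W ≃ V) :
    IsSDDMOn (M.submatrix e e) where
  offDiag_nonpos _ _ h := hM.offDiag_nonpos _ _ (e.injective.ne h)
  rowSum_nonneg _ := (hM.rowSum_nonneg _).trans_eq (e.sum_comp (M _)).symm
  posDef := hM.posDef.submatrix e.injective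

omit [DecidableEq V] in
theorem exists_sparse (hM : IsSDDMOn M) {q : ℕ} (hq : 4 ≤ q) :
    ∃ N : Matrix V V ℝ, IsSDDMOn N ∧ numOffDiag N ≤ Fintype.card V * (2 * q ^ 2) ∧
      SpectralBounds (1 + 10 / q) 1 N M := by
  classical
  obtain ⟨s, hs0, hcard, hs⟩ := exists_weighted_sparsifier hM.posDef hM.graphWeight_nonneg
    (graphMatrix_graphWeight hM.isSymm) hq
  refine ⟨graphMatrix s, ⟨fun i j h => ?_, fun i => ?_, ?_⟩, ?_, hs⟩
  · rw [graphMatrix_apply_of_ne s h]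
    exact neg_nonpos.2 (add_nonneg (hs0 _) (hs0 _))
  · exact (hs0 (.inr i)).trans_eq (rowSum_graphMatrix s i).symm
  · refine posDef_of_quadForm_pos (graphMatrix_isSymm s) fun x hx => ?_
    exact (quadForm_pos hM.posDef hx).trans_le ((hs x).2.trans_eq (one_mul _))
  · refine (numOffDiag_graphMatrix_le s).trans ?_
    rw [mul_left_comm]
    exact Nat.mul_le_mul_left 2 hcard

theorem isStronglyDominant_submatrix [Fintype W] [DecidableEq W] (hM : IsSDDMOn M) {f : W → V}
    (hf : Function.Injective f) {θ κ : ℝ} (hθ : 0 ≤ θ) (hκ : 1 ≤ κ) (hθκ : 2 ≤ θ * (κ - 1))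
    (h : ∀ i, κ * ∑ j, edgeWeight M (f i) (f j) ≤ M (f i) (f i)) :
    IsStronglyDominant θ (M.submatrix f f) := by
  have hweight : ∀ i, 0 ≤ ∑ j, edgeWeight M (f i) (f j) := fun i =>
    Finset.sum_nonneg fun j _ => hM.edgeWeight_nonneg _ _
  have hrow : ∀ i, (κ - 1) * ∑ j, edgeWeight M (f i) (f j) ≤ rowSum (M.submatrix f f) i := by
    intro i
    have hdiag := rowSum_add_sum_edgeWeight (M.submatrix f f) i
    simp only [edgeWeight_submatrix M hf, submatrix_apply] at hdiag
    linarith [h i]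
  refine ⟨⟨fun i j hij => hM.offDiag_nonpos _ _ (hf.ne hij), fun i => ?_,
    hM.posDef.submatrix hf⟩, fun i => ?_⟩
  · exact (mul_nonneg (sub_nonneg.2 hκ) (hweight i)).trans (hrow i)
  · simp only [edgeWeight_submatrix M hf]
    calc 2 * ∑ j, edgeWeight M (f i) (f j) ≤ θ * (κ - 1) * ∑ j, edgeWeight M (f i) (f j) :=
          mul_le_mul_of_nonneg_right hθκ (hweight i)
      _ ≤ θ * rowSum (M.submatrix f f) i := by
          rw [mul_assoc]
          exact mul_le_mul_of_nonneg_left (hrow i) hθ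

end IsSDDMOn

theorem IsSDDM.isSDDMOn {n : ℕ} {M : Matrix (Fin n) (Fin n) ℝ} (hM : IsSDDM M) : IsSDDMOn M := by
  have hweight : ∀ i j, edgeWeight M i j = if i = j then 0 else |M i j| := by
    intro i j
    by_cases h : i = j
    · simp [h]
    · rw [edgeWeight_of_ne M h, if_neg h, abs_of_nonpos (hM.offDiag_nonpos i j h)]
  have hrow : 0 ≤ rowSum M := by
    intro i
    have hsum : ∑ j, edgeWeight M i j = ∑ j ∈ Finset.univ.erase i, |M i j| := by
      rw [← Finset.add_sum_erase _ _ (Finset.mem_univ i), edgeWeight_self, zero_add]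
      exact Finset.sum_congr rfl fun j hj => by
        rw [hweight, if_neg (Finset.ne_of_mem_erase hj).symm]
    have hdom := hM.diagDominant i
    rwa [← rowSum_add_sum_edgeWeight M i, hsum, le_add_iff_nonneg_left] at hdom
  have hpsd : M.PosSemidef := posSemidef_of_quadForm_nonneg hM.symm fun x =>
    quadForm_nonneg_of_edgeWeight_nonneg hM.symm
      (fun i j => by rw [hweight]; split_ifs <;> simp) hrow x
  exact ⟨hM.offDiag_nonpos, hrow,
    hpsd.posDef_iff_isUnit.2 ((isUnit_iff_isUnit_det _).2 hM.nonsingular)⟩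

end DiagonallyDominant

/-! ## A large strongly dominant block -/

section Coloring

variable {V : Type*} [Fintype V]

theorem card_le_two_mul_card_filter_le {g : V → ℕ} {m : ℕ} (hm : 0 < m)
    (h : ∑ i, g i ≤ Fintype.card V * m) :
    Fintype.card V ≤ 2 * (Finset.univ.filter fun i => g i ≤ 2 * m).card := by
  have hmarkov : (Finset.univ.filter fun i => ¬ g i ≤ 2 * m).card * (2 * m) ≤
      Fintype.card V * m := by
    rw [← smul_eq_mul]
    refine (Finset.card_nsmul_le_sum _ g _ fun i hi => ?_).trans
      ((Finset.sum_le_sum_of_subset (Finset.filter_subset _ _)).trans h)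
    have := (Finset.mem_filter.1 hi).2
    omega
  have hcard := Finset.card_filter_add_card_filter_not (s := Finset.univ) fun i => g i ≤ 2 * m
  rw [Finset.card_univ] at hcard
  have : (Finset.univ.filter fun i => ¬ g i ≤ 2 * m).card * 2 ≤ Fintype.card V :=
    Nat.le_of_mul_le_mul_right (by linarith) hm
  omega

omit [Fintype V] in
theorem exists_card_le_mul_card_fiber {k : ℕ} [NeZero k] (s : Finset V) (f : V → Fin k) :
    ∃ c, s.card ≤ k * (s.filter fun i => f i = c).card := by
  have hk : (0 : ℝ) < k := by exact_mod_cast Nat.pos_of_ne_zero (NeZero.ne k)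
  have hcard : (Finset.univ : Finset (Fin k)).card • ((s.card : ℝ) / k) ≤ s.card := by
    rw [Finset.card_univ, Fintype.card_fin, nsmul_eq_mul, mul_div_cancel₀ _ hk.ne']
  obtain ⟨c, -, hc⟩ := Finset.exists_le_card_fiber_of_nsmul_le_card_of_maps_to
    (fun i _ => Finset.mem_univ (f i)) Finset.univ_nonempty hcard
  refine ⟨c, ?_⟩
  rw [div_le_iff₀' hk] at hc
  exact_mod_cast hc

/-- The total weight of the edges with equal colors at their ends, each counted in both
directions. The coloring of `exists_coloring` minimizes it. -/
def monochromaticWeight {k : ℕ} (w : V → V → ℝ) (f : V → Fin k) : ℝ :=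
  ∑ i, ∑ j, if f i = f j then w i j else 0

variable [DecidableEq V]

theorem sum_sum_eq_erase_add {g : V → V → ℝ} (hg : ∀ i j, g i j = g j i) (a : V)
    (ha : g a a = 0) :
    ∑ i, ∑ j, g i j = ∑ i ∈ Finset.univ.erase a, ∑ j ∈ Finset.univ.erase a, g i j +
      2 * ∑ j ∈ Finset.univ.erase a, g a j := by
  have hsplit : ∀ f : V → ℝ, ∑ i, f i = f a + ∑ i ∈ Finset.univ.erase a, f i := fun f =>
    (Finset.add_sum_erase _ f (Finset.mem_univ a)).symm
  rw [hsplit, hsplit (g a), ha, Finset.sum_congr rfl fun i _ => hsplit (g i),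
    Finset.sum_add_distrib, Finset.sum_congr rfl fun i _ => hg i a]
  ring

variable {k : ℕ} {w : V → V → ℝ}

theorem monochromaticWeight_update (hw : ∀ i j, w i j = w j i) (hw0 : ∀ i, w i i = 0)
    (f : V → Fin k) (a : V) (c : Fin k) :
    monochromaticWeight w (Function.update f a c) =
      ∑ i ∈ Finset.univ.erase a, ∑ j ∈ Finset.univ.erase a, (if f i = f j then w i j else 0) +
        2 * ∑ j with f j = c, w a j := by
  have hsymm : ∀ i j, (if Function.update f a c i = Function.update f a c j then w i j else 0) =
      if Function.update f a c j = Function.update f a c i then w j i else 0 := by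
    intro i j
    simp only [hw i j, eq_comm]
  have hupdate : ∀ j ∈ Finset.univ.erase a, Function.update f a c j = f j := fun j hj =>
    Function.update_of_ne (Finset.ne_of_mem_erase hj) _ _
  rw [monochromaticWeight, sum_sum_eq_erase_add hsymm a (by simp [hw0])]
  congr 1
  · exact Finset.sum_congr rfl fun i hi => Finset.sum_congr rfl fun j hj => by
      rw [hupdate i hi, hupdate j hj]
  · rw [Finset.sum_filter]
    refine congrArg _ (.trans (Finset.sum_congr rfl fun j hj => ?_)
      (Finset.sum_erase (a := a) _ (by simp [hw0])))
    simp only [Function.update_self, hupdate j hj, eq_comm]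

omit [DecidableEq V] in
theorem exists_coloring [NeZero k] (hw : ∀ i j, w i j = w j i) (hw0 : ∀ i, w i i = 0) :
    ∃ f : V → Fin k, ∀ i, k * ∑ j with f j = f i, w i j ≤ ∑ j, w i j := by
  classical
  obtain ⟨f, hf⟩ := Finite.exists_min fun f : V → Fin k => monochromaticWeight w f
  refine ⟨f, fun a => ?_⟩
  have hmove : ∀ c, ∑ j with f j = f a, w a j ≤ ∑ j with f j = c, w a j := by
    intro c
    have h := hf (Function.update f a c)
    rw [← Function.update_eq_self a f, monochromaticWeight_update hw hw0, Function.update_eq_self,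
      monochromaticWeight_update hw hw0] at h
    linarith
  calc (k : ℝ) * ∑ j with f j = f a, w a j = ∑ _c : Fin k, ∑ j with f j = f a, w a j := by simp
    _ ≤ ∑ c, ∑ j with f j = c, w a j := Finset.sum_le_sum fun c _ => hmove c
    _ = ∑ j, w a j := Finset.sum_fiberwise _ _ _

theorem IsSDDMOn.exists_dominant_subset {N : Matrix V V ℝ} (hN : IsSDDMOn N) (k : ℕ) [NeZero k]
    {m : ℕ} (hm : 0 < m) (hcard : numOffDiag N ≤ Fintype.card V * m) :
    ∃ F : Finset V, Fintype.card V ≤ 2 * (k * F.card) ∧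
      (∀ i ∈ F, (offDiagSupport N i).card ≤ 2 * m) ∧
      ∀ i ∈ F, k * ∑ j ∈ F, edgeWeight N i j ≤ N i i := by
  obtain ⟨f, hf⟩ := exists_coloring (k := k) (edgeWeight_comm hN.isSymm) (edgeWeight_self N)
  set B := Finset.univ.filter fun i => (offDiagSupport N i).card ≤ 2 * m
  have hB : Fintype.card V ≤ 2 * B.card := card_le_two_mul_card_filter_le hm hcard
  obtain ⟨c, hc⟩ := exists_card_le_mul_card_fiber B f
  refine ⟨B.filter fun i => f i = c, by omega, fun i hi => ?_, fun i hi => ?_⟩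
  · exact (Finset.mem_filter.1 (Finset.mem_filter.1 hi).1).2
  · have hclass : (B.filter fun j => f j = c) ⊆ Finset.univ.filter fun j => f j = f i := by
      intro j hj
      simp [(Finset.mem_filter.1 hj).2, (Finset.mem_filter.1 hi).2]
    calc (k : ℝ) * ∑ j ∈ B.filter fun i => f i = c, edgeWeight N i j
        ≤ k * ∑ j with f j = f i, edgeWeight N i j := by
          refine mul_le_mul_of_nonneg_left ?_ (Nat.cast_nonneg k)
          exact Finset.sum_le_sum_of_subset_of_nonneg hclass fun j _ _ => hN.edgeWeight_nonneg i j
      _ ≤ N i i := (hf i).trans (hN.sum_edgeWeight_le i)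

end Coloring

/-! ## Approximate block elimination -/

section LaplacianPart

open Matrix

variable {V : Type*} [Fintype V] [DecidableEq V]

/-- The Laplacian of the graph with the edge weights of `A`: what is left of `A` without its excess
diagonal. -/
def laplacianPart (A : Matrix V V ℝ) : Matrix V V ℝ :=
  A - diagonal (rowSum A)

variable {A : Matrix V V ℝ}

theorem laplacianPart_isSymm (hA : A.IsSymm) : (laplacianPart A).IsSymm :=
  hA.sub (isSymm_diagonal _)

theorem quadForm_eq_diagonal_add_laplacianPart (A : Matrix V V ℝ) (x : V → ℝ) :
    quadForm A x = quadForm (diagonal (rowSum A)) x + quadForm (laplacianPart A) x := by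
  rw [← quadForm_add, laplacianPart, add_sub_cancel]

theorem quadForm_laplacianPart (hA : A.IsSymm) (x : V → ℝ) :
    quadForm (laplacianPart A) x = (∑ i, ∑ j, edgeWeight A i j * (x i - x j) ^ 2) / 2 := by
  rw [laplacianPart, quadForm_sub, quadForm_eq_sum_edges hA, add_sub_cancel_right]

theorem IsSDDMOn.laplacianPart_posSemidef (hA : IsSDDMOn A) : (laplacianPart A).PosSemidef := by
  refine posSemidef_of_quadForm_nonneg (laplacianPart_isSymm hA.isSymm) fun x => ?_
  rw [quadForm_laplacianPart hA.isSymm]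
  exact div_nonneg (Finset.sum_nonneg fun i _ => Finset.sum_nonneg fun j _ =>
    mul_nonneg (hA.edgeWeight_nonneg i j) (sq_nonneg _)) two_pos.le

theorem IsSDDMOn.quadForm_laplacianPart_le (hA : IsSDDMOn A) (x : V → ℝ) :
    quadForm (laplacianPart A) x ≤ 2 * ∑ i, (∑ j, edgeWeight A i j) * x i ^ 2 := by
  have hedge : ∀ i j, edgeWeight A i j * (x i - x j) ^ 2 ≤
      edgeWeight A i j * (2 * x i ^ 2) + edgeWeight A i j * (2 * x j ^ 2) := by
    intro i j
    rw [← mul_add]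
    refine mul_le_mul_of_nonneg_left ?_ (hA.edgeWeight_nonneg i j)
    linarith [sq_nonneg (x i + x j)]
  have hswap : ∑ i, ∑ j, edgeWeight A i j * (2 * x j ^ 2) =
      ∑ i, ∑ j, edgeWeight A i j * (2 * x i ^ 2) := by
    rw [Finset.sum_comm]
    simp only [edgeWeight_comm hA.isSymm]
  rw [quadForm_laplacianPart hA.isSymm]
  calc (∑ i, ∑ j, edgeWeight A i j * (x i - x j) ^ 2) / 2
      ≤ (∑ i, ∑ j, (edgeWeight A i j * (2 * x i ^ 2) + edgeWeight A i j * (2 * x j ^ 2))) / 2 := by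
        gcongr with i _ j _
        exact hedge i j
    _ = 2 * ∑ i, (∑ j, edgeWeight A i j) * x i ^ 2 := by
        simp only [Finset.sum_add_distrib, hswap, ← Finset.sum_mul, Finset.mul_sum,
          add_self_div_two]
        exact Finset.sum_congr rfl fun i _ => by ring

namespace IsStronglyDominant

variable {θ : ℝ}

theorem quadForm_laplacianPart_le (hA : IsStronglyDominant θ A) (x : V → ℝ) :
    quadForm (laplacianPart A) x ≤ θ * quadForm (diagonal (rowSum A)) x := by
  refine (hA.toIsSDDMOn.quadForm_laplacianPart_le x).trans ?_
  rw [quadForm_diagonal, Finset.mul_sum, Finset.mul_sum]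
  refine Finset.sum_le_sum fun i _ => ?_
  rw [← mul_assoc, ← mul_assoc]
  exact mul_le_mul_of_nonneg_right (hA.dominant i) (sq_nonneg _)

theorem spectralBounds_diagonal (hA : IsStronglyDominant θ A) :
    SpectralBounds 1 (1 + θ) (diagonal (rowSum A)) A := fun x => by
  have hnonneg := quadForm_nonneg hA.laplacianPart_posSemidef x
  have hle := hA.quadForm_laplacianPart_le x
  rw [quadForm_eq_diagonal_add_laplacianPart A]
  constructor <;> linarith

theorem rowSum_pos (hA : IsStronglyDominant θ A) (i : V) : 0 < rowSum A i := by
  refine (hA.rowSum_nonneg i).lt_of_ne fun hzero => ?_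
  have hweight : 2 * ∑ j, edgeWeight A i j ≤ 0 := by
    simpa only [← hzero, Pi.zero_apply, mul_zero] using hA.dominant i
  have hdiag := rowSum_add_sum_edgeWeight A i
  have hpos : 0 < A i i := hA.posDef.diag_pos
  simp only [← hzero, Pi.zero_apply] at hdiag
  linarith

theorem quadForm_inv_mul_laplacianPart_le (hA : IsStronglyDominant θ A) (x : V → ℝ) :
    quadForm (diagonal (rowSum A)) ((diagonal (rowSum A)⁻¹ * laplacianPart A) *ᵥ x) ≤
      θ * quadForm (laplacianPart A) x := by
  set p := (diagonal (rowSum A)⁻¹ * laplacianPart A) *ᵥ x with hp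
  have hcancel : diagonal (rowSum A) *ᵥ p = laplacianPart A *ᵥ x := by
    rw [hp, mulVec_mulVec, ← Matrix.mul_assoc, diagonal_mul_diagonal]
    simp only [Pi.inv_apply, mul_inv_cancel₀ (hA.rowSum_pos _).ne', diagonal_one, Matrix.one_mul]
  have hcs : quadForm (diagonal (rowSum A)) p ^ 2 ≤
      quadForm (laplacianPart A) p * quadForm (laplacianPart A) x := by
    rw [quadForm, hcancel]
    exact dotProduct_mulVec_sq_le hA.laplacianPart_posSemidef p x
  have hle := mul_le_mul_of_nonneg_right (hA.quadForm_laplacianPart_le p)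
    (quadForm_nonneg hA.laplacianPart_posSemidef x)
  rcases eq_or_ne p 0 with h | h
  · have hx : laplacianPart A *ᵥ x = 0 := by rw [← hcancel, h, mulVec_zero]
    rw [h, quadForm_zero, quadForm, hx, dotProduct_zero, mul_zero]
  · have hpos : 0 < quadForm (diagonal (rowSum A)) p :=
      quadForm_pos (posDef_diagonal_iff.2 hA.rowSum_pos) h
    refine le_of_mul_le_mul_left ?_ hpos
    linarith

end IsStronglyDominant

end LaplacianPart

section Jacobi

open Matrix

variable {F C : Type*} [Fintype F] [DecidableEq F]

/-- The Jacobi iterates for `A * H = B`, preconditioned by the excess diagonal of `A`. -/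
noncomputable def jacobi (A : Matrix F F ℝ) (B : Matrix F C ℝ) : ℕ → Matrix F C ℝ
  | 0 => 0
  | s + 1 => diagonal (rowSum A)⁻¹ * (B - laplacianPart A * jacobi A B s)

variable {A : Matrix F F ℝ}

theorem rowSupport_jacobi_succ_subset [Fintype C] [DecidableEq C] (A : Matrix F F ℝ)
    (B : Matrix F C ℝ) (s : ℕ) (i : F) :
    rowSupport (jacobi A B (s + 1)) i ⊆
      rowSupport B i ∪ (insert i (offDiagSupport A i)).biUnion (rowSupport (jacobi A B s)) := by
  intro j hj
  contrapose! hj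
  simp only [Finset.mem_union, Finset.mem_biUnion, mem_rowSupport, not_or, not_not, not_exists,
    not_and] at hj
  obtain ⟨hB, hJ⟩ := hj
  rw [mem_rowSupport, not_not, jacobi, diagonal_mul, Matrix.sub_apply, hB, mul_apply,
    Finset.sum_eq_zero fun k _ => ?_, sub_zero, mul_zero]
  by_cases hk : k ∈ insert i (offDiagSupport A i)
  · rw [hJ k hk, mul_zero]
  · simp only [Finset.mem_insert, mem_offDiagSupport, not_or, not_and, not_not] at hk
    rw [laplacianPart, Matrix.sub_apply, hk.2 hk.1, diagonal_apply_ne _ (Ne.symm hk.1), sub_zero,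
      zero_mul]

theorem card_rowSupport_jacobi_lt [Fintype C] {B : Matrix F C ℝ} {m : ℕ}
    (hm : ∀ i, (offDiagSupport A i).card + (rowSupport B i).card ≤ m) (s : ℕ) (i : F) :
    (rowSupport (jacobi A B s) i).card < (m + 1) ^ s := by
  classical
  induction s generalizing i with
  | zero => simp [jacobi, rowSupport]
  | succ s ih =>
    obtain ⟨r, hr⟩ := Nat.exists_eq_add_of_le' (Nat.one_le_pow s (m + 1) (by omega))
    have hunion : ((insert i (offDiagSupport A i)).biUnion (rowSupport (jacobi A B s))).card ≤
        ((offDiagSupport A i).card + 1) * r :=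
      (Finset.card_biUnion_le_card_mul _ _ r fun k _ => by have := ih k; omega).trans
        (Nat.mul_le_mul_right r (Finset.card_insert_le _ _))
    have hcard := (Finset.card_le_card (rowSupport_jacobi_succ_subset A B s i)).trans
      (Finset.card_union_le _ _)
    have := hm i
    rw [pow_succ, hr]
    nlinarith

variable [Fintype C]

theorem jacobi_succ_mulVec_sub (hA : A.PosDef) (hrow : ∀ i, rowSum A i ≠ 0) (B : Matrix F C ℝ)
    (y : C → ℝ) (s : ℕ) :
    jacobi A B (s + 1) *ᵥ y - (A⁻¹ * B) *ᵥ y =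
      -((diagonal (rowSum A)⁻¹ * laplacianPart A) *ᵥ (jacobi A B s *ᵥ y - (A⁻¹ * B) *ᵥ y)) := by
  have hfix : diagonal (rowSum A)⁻¹ * B = A⁻¹ * B + diagonal (rowSum A)⁻¹ * laplacianPart A *
      (A⁻¹ * B) := by
    have hB : B = (diagonal (rowSum A) + laplacianPart A) * (A⁻¹ * B) := by
      rw [laplacianPart, add_sub_cancel, ← Matrix.mul_assoc,
        mul_nonsing_inv _ (isUnit_det_of_posDef hA), Matrix.one_mul]
    conv_lhs => rw [hB]
    rw [← Matrix.mul_assoc, Matrix.mul_add, diagonal_mul_diagonal, Matrix.add_mul]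
    simp only [Pi.inv_apply, inv_mul_cancel₀ (hrow _), diagonal_one, Matrix.one_mul]
  rw [jacobi, ← sub_mulVec, ← sub_mulVec, mulVec_mulVec, ← neg_mulVec, Matrix.mul_sub,
    Matrix.mul_sub, hfix, Matrix.mul_assoc (diagonal _) _ (jacobi A B s)]
  congr 1
  abel

namespace IsStronglyDominant

variable {θ : ℝ}

theorem quadForm_diagonal_jacobi_sub_le (hA : IsStronglyDominant θ A) (hθ : 0 ≤ θ)
    (B : Matrix F C ℝ) (y : C → ℝ) (s : ℕ) :
    quadForm (diagonal (rowSum A)) (jacobi A B (s + 1) *ᵥ y - (A⁻¹ * B) *ᵥ y) ≤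
      θ * (θ ^ s) ^ 2 * quadForm (laplacianPart A) ((A⁻¹ * B) *ᵥ y) := by
  have hstep : ∀ s, quadForm (diagonal (rowSum A)) (jacobi A B (s + 1) *ᵥ y - (A⁻¹ * B) *ᵥ y) ≤
      θ * quadForm (laplacianPart A) (jacobi A B s *ᵥ y - (A⁻¹ * B) *ᵥ y) := fun s => by
    rw [jacobi_succ_mulVec_sub hA.posDef (fun i => (hA.rowSum_pos i).ne'), quadForm_neg_vec]
    exact hA.quadForm_inv_mul_laplacianPart_le _
  induction s with
  | zero => simpa [jacobi, quadForm_neg_vec] using hstep 0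
  | succ s ih =>
    calc quadForm (diagonal (rowSum A)) (jacobi A B (s + 2) *ᵥ y - (A⁻¹ * B) *ᵥ y)
        ≤ θ * (θ * quadForm (diagonal (rowSum A))
            (jacobi A B (s + 1) *ᵥ y - (A⁻¹ * B) *ᵥ y)) :=
          (hstep (s + 1)).trans (mul_le_mul_of_nonneg_left (hA.quadForm_laplacianPart_le _) hθ)
      _ ≤ θ * (θ * (θ * (θ ^ s) ^ 2 * quadForm (laplacianPart A) ((A⁻¹ * B) *ᵥ y))) := by
          gcongr
      _ = θ * (θ ^ (s + 1)) ^ 2 * quadForm (laplacianPart A) ((A⁻¹ * B) *ᵥ y) := by ring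

theorem quadForm_jacobi_sub_le (hA : IsStronglyDominant θ A) (hθ : 0 ≤ θ) (hθ' : θ ≤ 1 / 2)
    (B : Matrix F C ℝ) (y : C → ℝ) (s : ℕ) :
    quadForm A (jacobi A B (s + 1) *ᵥ y - (A⁻¹ * B) *ᵥ y) ≤
      (θ ^ s) ^ 2 * quadForm (laplacianPart A) ((A⁻¹ * B) *ᵥ y) := by
  have hL := quadForm_nonneg hA.laplacianPart_posSemidef ((A⁻¹ * B) *ᵥ y)
  have hθ1 : (1 + θ) * θ ≤ 1 := by nlinarith
  calc quadForm A (jacobi A B (s + 1) *ᵥ y - (A⁻¹ * B) *ᵥ y)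
      ≤ (1 + θ) * (θ * (θ ^ s) ^ 2 * quadForm (laplacianPart A) ((A⁻¹ * B) *ᵥ y)) :=
        (hA.spectralBounds_diagonal _).2.trans
          (mul_le_mul_of_nonneg_left (hA.quadForm_diagonal_jacobi_sub_le hθ B y s) (by linarith))
    _ = (1 + θ) * θ * ((θ ^ s) ^ 2 * quadForm (laplacianPart A) ((A⁻¹ * B) *ᵥ y)) := by ring
    _ ≤ (θ ^ s) ^ 2 * quadForm (laplacianPart A) ((A⁻¹ * B) *ᵥ y) :=
        mul_le_of_le_one_left (mul_nonneg (sq_nonneg _) hL) hθ1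

end IsStronglyDominant

end Jacobi

section SchurComplement

open Matrix

variable {F C : Type*} [Fintype F] [DecidableEq F]

omit [DecidableEq F] in
/-- The minimum principle: pairing `A x` with the negative part of `x` would otherwise give a
negative value. -/
theorem nonneg_of_mulVec_nonneg {A : Matrix F F ℝ} (hA : A.PosDef)
    (hoff : ∀ i j, i ≠ j → A i j ≤ 0) {x : F → ℝ} (hx : 0 ≤ A *ᵥ x) : 0 ≤ x := by
  classical
  have hneg : x⁻ ⬝ᵥ A *ᵥ x⁺ ≤ 0 := by
    simp only [dotProduct, mulVec, Finset.mul_sum]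
    refine Finset.sum_nonpos fun i _ => Finset.sum_nonpos fun j _ => ?_
    by_cases hij : i = j
    · have hdisjoint : x⁻ i * x⁺ i = 0 := by
        rcases le_total (x i) 0 with h | h
        · simp [posPart_eq_zero.2 h]
        · simp [negPart_eq_zero.2 h]
      rw [← hij, mul_left_comm, hdisjoint, mul_zero]
    · exact mul_nonpos_of_nonneg_of_nonpos (negPart_nonneg x i)
        (mul_nonpos_of_nonpos_of_nonneg (hoff i j hij) (posPart_nonneg x j))
  have hpair : 0 ≤ x⁻ ⬝ᵥ A *ᵥ x := dotProduct_nonneg_of_nonneg (negPart_nonneg x) hx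
  have hzero : x⁻ = 0 := by
    by_contra hne
    have hpos := quadForm_pos hA hne
    rw [← posPart_sub_negPart x, mulVec_sub, dotProduct_sub] at hpair
    rw [quadForm] at hpos
    simp only [posPart_sub_negPart] at hpair
    linarith
  exact negPart_eq_zero.1 hzero

theorem inv_mulVec_nonneg {A : Matrix F F ℝ} (hA : A.PosDef) (hoff : ∀ i j, i ≠ j → A i j ≤ 0)
    {b : F → ℝ} (hb : 0 ≤ b) : 0 ≤ A⁻¹ *ᵥ b := by
  refine nonneg_of_mulVec_nonneg hA hoff ?_
  rwa [mulVec_mulVec, mul_nonsing_inv _ (isUnit_det_of_posDef hA), one_mulVec]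

variable [Fintype C]

theorem quadForm_fromBlocks {A : Matrix F F ℝ} (hA : A.PosDef) (B : Matrix F C ℝ)
    (D : Matrix C C ℝ) (x : F → ℝ) (y : C → ℝ) :
    quadForm (fromBlocks A B Bᵀ D) (Sum.elim x y) =
      quadForm A (x + (A⁻¹ * B) *ᵥ y) + quadForm (D - Bᵀ * A⁻¹ * B) y := by
  have : Invertible A := hA.isUnit.invertible
  have h := schur_complement_eq₁₁ B D x y hA.1
  simp only [conjTranspose_eq_transpose_of_trivial, star_trivial] at h
  rwa [← dotProduct_mulVec, ← dotProduct_mulVec, ← dotProduct_mulVec] at h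

theorem quadForm_schur {A : Matrix F F ℝ} (hA : A.PosDef) (B : Matrix F C ℝ) (D : Matrix C C ℝ)
    (y : C → ℝ) :
    quadForm (D - Bᵀ * A⁻¹ * B) y =
      quadForm (fromBlocks A B Bᵀ D) (Sum.elim (-((A⁻¹ * B) *ᵥ y)) y) := by
  rw [quadForm_fromBlocks hA, neg_add_cancel, quadForm_zero, zero_add]

namespace IsSDDMOn

variable {A : Matrix F F ℝ} {B : Matrix F C ℝ} {D : Matrix C C ℝ}

omit [DecidableEq F] in
theorem posDef_block (h : IsSDDMOn (fromBlocks A B Bᵀ D)) : A.PosDef :=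
  h.posDef.submatrix (e := Sum.inl) Sum.inl_injective

omit [DecidableEq F] in
theorem coupling_nonpos (h : IsSDDMOn (fromBlocks A B Bᵀ D)) (i : F) (j : C) : B i j ≤ 0 :=
  h.offDiag_nonpos (.inl i) (.inr j) Sum.inl_ne_inr

omit [DecidableEq F] in
theorem block_offDiag_nonpos (h : IsSDDMOn (fromBlocks A B Bᵀ D)) (i j : F) (hij : i ≠ j) :
    A i j ≤ 0 :=
  h.offDiag_nonpos (.inl i) (.inl j) (Sum.inl_injective.ne hij)

theorem schur_offDiag_nonpos (h : IsSDDMOn (fromBlocks A B Bᵀ D)) (i j : C) (hij : i ≠ j) :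
    (D - Bᵀ * A⁻¹ * B) i j ≤ 0 := by
  have hD : D i j ≤ 0 := h.offDiag_nonpos (.inr i) (.inr j) (Sum.inr_injective.ne hij)
  have hcorrection : (Bᵀ * A⁻¹ * B) i j = -B.col i ⬝ᵥ A⁻¹ *ᵥ -B.col j := by
    rw [Matrix.mul_assoc, mulVec_neg, neg_dotProduct_neg, dotProduct_mulVec, ← dotProduct_mulVec]
    rfl
  rw [Matrix.sub_apply, hcorrection]
  refine sub_nonpos.2 (hD.trans (dotProduct_nonneg_of_nonneg
    (fun k => neg_nonneg.2 (h.coupling_nonpos k i)) ?_))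
  exact inv_mulVec_nonneg h.posDef_block h.block_offDiag_nonpos
    fun k => neg_nonneg.2 (h.coupling_nonpos k j)

/-- The row sums of the Schur complement are those of its rows in the block matrix minus
`Bᵀ (A⁻¹ a)`, where `a` are the row sums of the eliminated rows. -/
theorem schur_rowSum_nonneg (h : IsSDDMOn (fromBlocks A B Bᵀ D)) :
    0 ≤ rowSum (D - Bᵀ * A⁻¹ * B) := by
  have hdet := isUnit_det_of_posDef h.posDef_block
  have hF : 0 ≤ A *ᵥ 1 + B *ᵥ 1 := fun i => by
    simpa [rowSum, mulVec, dotProduct] using h.rowSum_nonneg (.inl i)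
  have hC : 0 ≤ Bᵀ *ᵥ 1 + D *ᵥ 1 := fun i => by
    simpa [rowSum, mulVec, dotProduct] using h.rowSum_nonneg (.inr i)
  have hsplit : rowSum (D - Bᵀ * A⁻¹ * B) =
      (Bᵀ *ᵥ 1 + D *ᵥ 1) + (-Bᵀ) *ᵥ A⁻¹ *ᵥ (A *ᵥ 1 + B *ᵥ 1) := by
    have hcancel : A⁻¹ *ᵥ A *ᵥ (1 : F → ℝ) = 1 := by
      rw [mulVec_mulVec, nonsing_inv_mul _ hdet, one_mulVec]
    rw [rowSum_eq_mulVec_one, sub_mulVec, mulVec_add, hcancel, neg_mulVec, mulVec_add,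
      ← mulVec_mulVec, ← mulVec_mulVec]
    abel
  rw [hsplit]
  refine add_nonneg hC fun i => dotProduct_nonneg_of_nonneg
    (fun k => neg_nonneg.2 (h.coupling_nonpos k i)) ?_
  exact inv_mulVec_nonneg h.posDef_block h.block_offDiag_nonpos hF

theorem schur_posDef (h : IsSDDMOn (fromBlocks A B Bᵀ D)) : (D - Bᵀ * A⁻¹ * B).PosDef := by
  have hD : D.IsSymm := (isSymm_fromBlocks_iff.1 h.isSymm).2.2.2
  have hinv := isSymm_of_posSemidef h.posDef_block.inv.posSemidef
  refine posDef_of_quadForm_pos (hD.sub ?_) fun y hy => ?_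
  · rw [IsSymm, transpose_mul, transpose_mul, transpose_transpose, hinv.eq, Matrix.mul_assoc]
  · rw [quadForm_schur h.posDef_block]
    refine quadForm_pos h.posDef fun hzero => hy ?_
    exact funext fun i => congrFun hzero (.inr i)

theorem schur (h : IsSDDMOn (fromBlocks A B Bᵀ D)) : IsSDDMOn (D - Bᵀ * A⁻¹ * B) :=
  ⟨h.schur_offDiag_nonpos, h.schur_rowSum_nonneg, h.schur_posDef⟩

theorem quadForm_laplacianPart_block_le (h : IsSDDMOn (fromBlocks A B Bᵀ D))
    (x : F → ℝ) (y : C → ℝ) :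
    quadForm (laplacianPart A) x ≤ quadForm (fromBlocks A B Bᵀ D) (Sum.elim x y) := by
  classical
  set M := fromBlocks A B Bᵀ D
  have hweight : ∀ i j, edgeWeight A i j = edgeWeight M (.inl i) (.inl j) :=
    edgeWeight_submatrix M Sum.inl_injective
  have hterm : ∀ u v, 0 ≤ edgeWeight M u v * (Sum.elim x y u - Sum.elim x y v) ^ 2 := fun u v =>
    mul_nonneg (h.edgeWeight_nonneg u v) (sq_nonneg _)
  have hedges : ∑ i, ∑ j, edgeWeight A i j * (x i - x j) ^ 2 ≤
      ∑ u, ∑ v, edgeWeight M u v * (Sum.elim x y u - Sum.elim x y v) ^ 2 := by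
    simp only [hweight]
    rw [Fintype.sum_sum_type]
    refine le_add_of_le_of_nonneg (Finset.sum_le_sum fun i _ => ?_)
      (Finset.sum_nonneg fun u _ => Finset.sum_nonneg fun v _ => hterm _ _)
    rw [Fintype.sum_sum_type]
    exact le_add_of_nonneg_right (Finset.sum_nonneg fun v _ => hterm _ _)
  have hdiag : 0 ≤ quadForm (diagonal (rowSum M)) (Sum.elim x y) :=
    quadForm_nonneg (PosSemidef.diagonal h.rowSum_nonneg) _
  rw [quadForm_laplacianPart (isSymm_of_posSemidef h.posDef_block.posSemidef),
    quadForm_eq_sum_edges h.isSymm]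
  linarith

theorem quadForm_laplacianPart_le_schur (h : IsSDDMOn (fromBlocks A B Bᵀ D))
    (y : C → ℝ) :
    quadForm (laplacianPart A) ((A⁻¹ * B) *ᵥ y) ≤ quadForm (D - Bᵀ * A⁻¹ * B) y := by
  rw [quadForm_schur h.posDef_block, ← quadForm_neg_vec]
  exact h.quadForm_laplacianPart_block_le _ y

end IsSDDMOn

end SchurComplement

section BlockElimination

open Matrix

variable {F C : Type*} [Fintype F]

theorem quadForm_add_vec_add_le {A : Matrix F F ℝ} (hA : A.PosSemidef) {γ s : ℝ} (hγ : 0 ≤ γ)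
    (hs : 0 ≤ s) (a : F → ℝ) {e : F → ℝ} (he : quadForm A e ≤ γ ^ 2 * s) :
    quadForm A (a + e) + s ≤ (1 + γ) ^ 2 * (quadForm A a + s) := by
  have ha := quadForm_nonneg hA a
  have hcross : 2 * (a ⬝ᵥ A *ᵥ e) ≤ γ * (quadForm A a + s) := by
    refine le_of_sq_le_sq ?_ (mul_nonneg hγ (add_nonneg ha hs))
    have hcs := dotProduct_mulVec_sq_le hA a e
    have hprod := mul_le_mul_of_nonneg_left he ha
    nlinarith [mul_nonneg (sq_nonneg γ) (sq_nonneg (quadForm A a - s))]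
  rw [quadForm_add_vec (isSymm_of_posSemidef hA)]
  nlinarith [mul_nonneg hγ (add_nonneg ha hs), mul_nonneg (sq_nonneg γ) ha]

variable [Fintype C]

theorem quadForm_fromBlocks_diagonal (A : Matrix F F ℝ) (D : Matrix C C ℝ) (z : F ⊕ C → ℝ) :
    quadForm (fromBlocks A 0 0 D) z = quadForm A (z ∘ .inl) + quadForm D (z ∘ .inr) := by
  simp [quadForm, fromBlocks_mulVec, dotProduct]

theorem SpectralBounds.fromBlocks {a b : ℝ} {A A' : Matrix F F ℝ} {D D' : Matrix C C ℝ}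
    (hA : SpectralBounds a b A A') (hD : SpectralBounds a b D D') :
    SpectralBounds a b (fromBlocks A 0 0 D) (fromBlocks A' 0 0 D') := fun z => by
  simp only [quadForm_fromBlocks_diagonal, mul_add]
  exact ⟨add_le_add (hA _).1 (hD _).1, add_le_add (hA _).2 (hD _).2⟩

variable [DecidableEq F] [DecidableEq C]

theorem IsStronglyDominant.spectralBounds_jacobi {θ : ℝ} {A : Matrix F F ℝ} {B : Matrix F C ℝ}
    {D : Matrix C C ℝ} (hA : IsStronglyDominant θ A) (hθ : 0 ≤ θ) (hθ' : θ ≤ 1 / 2)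
    (h : IsSDDMOn (fromBlocks A B Bᵀ D)) (s : ℕ) :
    SpectralBounds ((1 + θ ^ s) ^ 2) ((1 + θ ^ s) ^ 2)
      ((fromBlocks 1 (jacobi A B (s + 1)) 0 1)ᵀ * fromBlocks A 0 0 (D - Bᵀ * A⁻¹ * B) *
        fromBlocks 1 (jacobi A B (s + 1)) 0 1)
      (fromBlocks A B Bᵀ D) := fun z => by
  obtain ⟨x, y, rfl⟩ : ∃ x y, z = Sum.elim x y := ⟨_, _, (Sum.elim_comp_inl_inr z).symm⟩
  set e := jacobi A B (s + 1) *ᵥ y - (A⁻¹ * B) *ᵥ y with he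
  have hS := quadForm_nonneg h.schur_posDef.posSemidef y
  have herror : quadForm A e ≤ (θ ^ s) ^ 2 * quadForm (D - Bᵀ * A⁻¹ * B) y :=
    (hA.quadForm_jacobi_sub_le hθ hθ' B y s).trans
      (mul_le_mul_of_nonneg_left (h.quadForm_laplacianPart_le_schur y) (sq_nonneg _))
  have happrox : fromBlocks 1 (jacobi A B (s + 1)) 0 1 *ᵥ Sum.elim x y =
      Sum.elim (x + (A⁻¹ * B) *ᵥ y + e) y := by
    rw [fromBlocks_mulVec, he, add_add_sub_cancel]
    simp
  rw [quadForm_transpose_mul_mul, happrox, quadForm_fromBlocks_diagonal, quadForm_fromBlocks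
    hA.posDef, Sum.elim_comp_inl, Sum.elim_comp_inr]
  refine ⟨quadForm_add_vec_add_le hA.posDef.posSemidef (pow_nonneg hθ s) hS _ herror, ?_⟩
  have hback := quadForm_add_vec_add_le hA.posDef.posSemidef (pow_nonneg hθ s) hS
    (x + (A⁻¹ * B) *ᵥ y + e) ((quadForm_neg_vec A e).trans_le herror)
  rwa [add_neg_cancel_right] at hback

end BlockElimination

/-! ## Level factorizations -/

section LevelTriangular

open Matrix

variable {V W : Type*}

/-- `A` is unit triangular for any order of the indices that refines the levels `ℓ`: its entries
off the diagonal lead from a level to a strictly higher one. The levels are `0, …, K - 1`; their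
number bounds the depth of a substitution that solves for a whole level at a time. -/
structure IsLevelTriangular (A : Matrix V V ℝ) (ℓ : V → ℕ) (K : ℕ) : Prop where
  diag_eq_one : ∀ v, A v v = 1
  level_lt_level : ∀ u v, u ≠ v → A u v ≠ 0 → ℓ u < ℓ v
  level_lt : ∀ v, ℓ v < K

namespace IsLevelTriangular

variable {A : Matrix V V ℝ} {ℓ : V → ℕ} {K : ℕ}

theorem submatrix (h : IsLevelTriangular A ℓ K) (e : W ≃ V) :
    IsLevelTriangular (A.submatrix e e) (ℓ ∘ e) K where
  diag_eq_one v := h.diag_eq_one (e v)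
  level_lt_level u v huv := h.level_lt_level (e u) (e v) (e.injective.ne huv)
  level_lt v := h.level_lt (e v)

theorem transpose (h : IsLevelTriangular A ℓ K) :
    IsLevelTriangular Aᵀ (fun v => K - 1 - ℓ v) K where
  diag_eq_one := h.diag_eq_one
  level_lt_level u v huv hA := by
    have := h.level_lt_level v u huv.symm hA
    have := h.level_lt u
    omega
  level_lt v := by
    have := h.level_lt v
    omega

theorem fromBlocks_one [DecidableEq W] (h : IsLevelTriangular A ℓ K) (H : Matrix W V ℝ) :
    IsLevelTriangular (fromBlocks 1 H 0 A) (Sum.elim (fun _ => 0) fun v => ℓ v + 1) (K + 1) where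
  diag_eq_one := by
    rintro (i | i)
    · exact one_apply_eq i
    · exact h.diag_eq_one i
  level_lt_level := by
    rintro (i | i) (j | j) hij hA
    · exact absurd (one_apply_ne fun hne => hij (congrArg Sum.inl hne)) hA
    · exact Nat.succ_pos _
    · exact absurd rfl hA
    · exact Nat.succ_lt_succ (h.level_lt_level i j (fun hne => hij (congrArg Sum.inr hne)) hA)
  level_lt := by
    rintro (_ | i)
    · exact Nat.succ_pos K
    · exact Nat.succ_lt_succ (h.level_lt i)

end IsLevelTriangular

theorem fromBlocks_toBlocks_of_isSymm {M : Matrix (V ⊕ W) (V ⊕ W) ℝ} (hM : M.IsSymm) :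
    fromBlocks M.toBlocks₁₁ M.toBlocks₁₂ M.toBlocks₁₂ᵀ M.toBlocks₂₂ = M := by
  conv_rhs => rw [← M.fromBlocks_toBlocks]
  rw [show M.toBlocks₁₂ᵀ = M.toBlocks₂₁ from Matrix.ext fun i j => hM.apply (.inr i) (.inl j)]

theorem numOffDiag_fromBlocks_one [Fintype V] [Fintype W] [DecidableEq W] (H : Matrix W V ℝ)
    (A : Matrix V V ℝ) :
    numOffDiag (fromBlocks 1 H 0 A) = ∑ i, (rowSupport H i).card + numOffDiag A := by
  have hone : ∀ i : W, offDiagSupport (1 : Matrix W W ℝ) i = ∅ := fun i =>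
    Finset.eq_empty_of_forall_notMem fun j hj =>
      (mem_offDiagSupport.1 hj).2 (one_apply_ne (mem_offDiagSupport.1 hj).1.symm)
  have hzero : ∀ i : V, rowSupport (0 : Matrix V W ℝ) i = ∅ := fun i =>
    Finset.eq_empty_of_forall_notMem fun j hj => mem_rowSupport.1 hj rfl
  simp only [numOffDiag, Fintype.sum_sum_type, card_offDiagSupport_fromBlocks_inl,
    card_offDiagSupport_fromBlocks_inr, hone, hzero, Finset.card_empty, zero_add]

end LevelTriangular

section LevelFactorization

open Matrix

variable {V W : Type*} [Fintype V] [Fintype W]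

theorem SpectralBounds.mono {a b a' b' : ℝ} {A B : Matrix V V ℝ} (h : SpectralBounds a b A B)
    (hB : B.PosSemidef) (hb : 0 < b) (haa' : a ≤ a') (hbb' : b ≤ b') :
    SpectralBounds a' b' A B := fun x => by
  have hBx := quadForm_nonneg hB x
  have hAx : 0 ≤ quadForm A x := nonneg_of_mul_nonneg_right (hBx.trans (h x).2) hb
  exact ⟨(h x).1.trans (mul_le_mul_of_nonneg_right haa' hBx),
    (h x).2.trans (mul_le_mul_of_nonneg_right hbb' hAx)⟩

/-- `Uᵀ * diagonal d * U` is an approximate factorization of `M`, within the factors `a` and `b`,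
in which `U` is triangular for `K` levels and has at most `T` nonzero entries off the diagonal. -/
structure IsLevelFactorization [DecidableEq V] (M U : Matrix V V ℝ) (d : V → ℝ) (ℓ : V → ℕ)
    (K : ℕ) (T a b : ℝ) : Prop extends IsLevelTriangular U ℓ K where
  numOffDiag_le : (numOffDiag U : ℝ) ≤ T
  spectralBounds : SpectralBounds a b (Uᵀ * diagonal d * U) M

namespace IsLevelFactorization

variable [DecidableEq V] [DecidableEq W] {M U : Matrix V V ℝ} {d : V → ℝ} {ℓ : V → ℕ} {K : ℕ}
  {T a b : ℝ}

theorem submatrix (h : IsLevelFactorization M U d ℓ K T a b) (e : W ≃ V) :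
    IsLevelFactorization (M.submatrix e e) (U.submatrix e e) (d ∘ e) (ℓ ∘ e) K T a b where
  toIsLevelTriangular := h.toIsLevelTriangular.submatrix e
  numOffDiag_le := (numOffDiag_submatrix U e).symm ▸ h.numOffDiag_le
  spectralBounds := by
    have := h.spectralBounds.submatrix e
    rwa [← submatrix_mul_equiv _ _ e e, ← submatrix_mul_equiv _ _ e e,
      submatrix_diagonal_equiv, ← transpose_submatrix] at this

theorem mono (h : IsLevelFactorization M U d ℓ K T a b) (hM : M.PosSemidef) (hb : 0 < b)
    {T' a' b' : ℝ} (hTT' : T ≤ T') (haa' : a ≤ a') (hbb' : b ≤ b') :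
    IsLevelFactorization M U d ℓ K T' a' b' :=
  ⟨h.toIsLevelTriangular, h.numOffDiag_le.trans hTT', h.spectralBounds.mono hM hb haa' hbb'⟩

theorem trans {N : Matrix V V ℝ} {a' b' : ℝ} (h : IsLevelFactorization N U d ℓ K T a b)
    (hN : SpectralBounds a' b' N M) (ha : 0 ≤ a) (hb' : 0 ≤ b') :
    IsLevelFactorization M U d ℓ K T (a * a') (b' * b) :=
  ⟨h.toIsLevelTriangular, h.numOffDiag_le, h.spectralBounds.trans hN ha hb'⟩

/-- The eliminated block becomes a new lowest level, and its excess diagonal supplies the new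
entries of the diagonal factor. -/
theorem extend {θ : ℝ} {A : Matrix W W ℝ} {B : Matrix W V ℝ} {D : Matrix V V ℝ}
    (hU : IsLevelFactorization (D - Bᵀ * A⁻¹ * B) U d ℓ K T a b)
    (h : IsSDDMOn (fromBlocks A B Bᵀ D)) (hA : IsStronglyDominant θ A) (hθ : 0 ≤ θ)
    (hθ' : θ ≤ 1 / 2) {m : ℕ} (hm : ∀ i, (offDiagSupport A i).card + (rowSupport B i).card ≤ m)
    (s : ℕ) (ha : 1 ≤ a) (hb : 1 + θ ≤ b) :
    IsLevelFactorization (fromBlocks A B Bᵀ D) (fromBlocks 1 (jacobi A B (s + 1)) 0 U)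
      (Sum.elim (rowSum A) d) (Sum.elim (fun _ => 0) fun v => ℓ v + 1) (K + 1)
      (Fintype.card W * (m + 1) ^ (s + 1) + T) (a * (1 + θ ^ s) ^ 2) ((1 + θ ^ s) ^ 2 * b) := by
  refine ⟨hU.toIsLevelTriangular.fromBlocks_one _, ?_, ?_⟩
  · have hrows : ∑ i, (rowSupport (jacobi A B (s + 1)) i).card ≤
        Fintype.card W * (m + 1) ^ (s + 1) := by
      rw [← smul_eq_mul, ← Finset.card_univ]
      exact Finset.sum_le_card_nsmul _ _ _ fun i _ => (card_rowSupport_jacobi_lt hm (s + 1) i).le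
    rw [numOffDiag_fromBlocks_one, Nat.cast_add]
    exact add_le_add (mod_cast hrows) hU.numOffDiag_le
  · have hfactor : (fromBlocks 1 (jacobi A B (s + 1)) 0 U)ᵀ * diagonal (Sum.elim (rowSum A) d) *
        fromBlocks 1 (jacobi A B (s + 1)) 0 U =
        (fromBlocks 1 (jacobi A B (s + 1)) 0 1)ᵀ *
          fromBlocks (diagonal (rowSum A)) 0 0 (Uᵀ * diagonal d * U) *
          fromBlocks 1 (jacobi A B (s + 1)) 0 1 := by
      simp only [← fromBlocks_diagonal, fromBlocks_transpose, fromBlocks_multiply,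
        transpose_one, transpose_zero, Matrix.one_mul, Matrix.mul_one, Matrix.zero_mul,
        Matrix.mul_zero, add_zero, zero_add, Matrix.mul_assoc]
    have hdiag := hA.spectralBounds_diagonal.mono hA.posDef.posSemidef (by linarith) ha hb
    rw [hfactor]
    exact ((hdiag.fromBlocks hU.spectralBounds).transpose_mul_mul _).trans
      (hA.spectralBounds_jacobi hθ hθ' h s) (zero_le_one.trans ha) (sq_nonneg _)

end IsLevelFactorization

variable [DecidableEq V]

/-- One round of elimination: sparsify, and eliminate a strongly dominant block `F`. What remains
to be factorized is the Schur complement `S`. -/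
theorem IsSDDMOn.exists_elimination {M : Matrix V V ℝ} (hM : IsSDDMOn M) {q : ℕ} (hq : 4 ≤ q)
    (s : ℕ) :
    ∃ (F : Finset V) (S : Matrix {v // v ∉ F} {v // v ∉ F} ℝ),
      Fintype.card V ≤ 10 * F.card ∧ IsSDDMOn S ∧
      ∀ U d ℓ K T a b, IsLevelFactorization S U d ℓ K T a b → 1 ≤ a → 3 / 2 ≤ b →
        ∃ U' d' ℓ', IsLevelFactorization M U' d' ℓ' (K + 1)
          (F.card * (4 * q ^ 2 + 1) ^ (s + 1) + T) (a * (1 + (1 / 2) ^ s) ^ 2 * (1 + 10 / q))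
          ((1 + (1 / 2) ^ s) ^ 2 * b) := by
  obtain ⟨N, hN, hNcard, hNM⟩ := hM.exists_sparse hq
  obtain ⟨F, hFcard, hFdeg, hFdom⟩ := hN.exists_dominant_subset 5 (by positivity) hNcard
  set e := Equiv.sumCompl (· ∈ F)
  have hNe := hN.submatrix_equiv e
  set A := (N.submatrix e e).toBlocks₁₁
  set B := (N.submatrix e e).toBlocks₁₂
  set D := (N.submatrix e e).toBlocks₂₂
  have hblocks : fromBlocks A B Bᵀ D = N.submatrix e e := fromBlocks_toBlocks_of_isSymm hNe.isSymm
  rw [← hblocks] at hNe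
  have hAdom : IsStronglyDominant (1 / 2) A :=
    hN.isStronglyDominant_submatrix Subtype.val_injective (κ := 5) (by norm_num) (by norm_num)
      (by norm_num) fun i => by
        rw [Finset.sum_coe_sort F fun j => edgeWeight N i j]
        exact_mod_cast hFdom i i.2
  have hdeg : ∀ i, (offDiagSupport A i).card + (rowSupport B i).card ≤ 4 * q ^ 2 := fun i => by
    rw [← card_offDiagSupport_fromBlocks_inl A B Bᵀ D, hblocks, card_offDiagSupport_submatrix]
    have := hFdeg i i.2
    exact this.trans (by omega)
  refine ⟨F, D - Bᵀ * A⁻¹ * B, by omega, hNe.schur, fun U d ℓ K T a b hU ha hb => ?_⟩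
  have hext := hU.extend hNe hAdom (by norm_num) le_rfl hdeg s ha (by linarith)
  rw [hblocks] at hext
  have hV := hext.submatrix e.symm
  rw [submatrix_submatrix, Equiv.self_comp_symm, submatrix_id_id] at hV
  have hfinal := hV.trans hNM (mul_nonneg (zero_le_one.trans ha) (sq_nonneg _)) zero_le_one
  rw [one_mul, Fintype.card_coe] at hfinal
  exact ⟨_, _, _, mod_cast hfinal⟩

theorem fill_add_le {n f r P T T' : ℝ} (hn : 0 ≤ n) (hf : f ≤ n) (hr : r ≤ 9 / 10 * n)
    (hP : 0 ≤ P) (hT' : 0 ≤ T') (hT : P + 9 / 10 * T' ≤ T) : f * P + T' * r ≤ T * n :=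
  calc f * P + T' * r ≤ n * P + T' * (9 / 10 * n) := by gcongr
    _ = (P + 9 / 10 * T') * n := by ring
    _ ≤ T * n := by gcongr

/-- The parameters of the round at depth `j` of the recursion are the sparsification parameter
`q j` and the number `t j` of Jacobi steps; `T j` bounds the fill per row and `c j` the error from
depth `j` on. Every round eliminates a tenth of the rows. -/
theorem exists_levelFactorization {q t : ℕ → ℕ} {T c : ℕ → ℝ} (hq : ∀ j, 4 ≤ q j)
    (hT0 : ∀ j, 0 ≤ T j) (hc1 : ∀ j, 1 ≤ c j)
    (hT : ∀ j, (4 * q j ^ 2 + 1) ^ (t j + 1) + 9 / 10 * T (j + 1) ≤ T j)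
    (hc : ∀ j, (1 + 10 / q j) * ((1 + (1 / 2) ^ t j) ^ 2 * c (j + 1)) ≤ c j)
    (j : ℕ) {M : Matrix V V ℝ} (hM : IsSDDMOn M) :
    ∃ U d ℓ K, (10 / 9 : ℝ) ^ K ≤ max (1 : ℝ) (10 / 9 * Fintype.card V) ∧
      IsLevelFactorization M U d ℓ K (T j * Fintype.card V) (c j) (3 / 2 * c j) := by
  obtain ⟨n, hn⟩ : ∃ n, Fintype.card V = n := ⟨_, rfl⟩
  induction n using Nat.strong_induction_on generalizing j V with
  | _ n ih =>
  obtain ⟨F, S, hF, hS, hextend⟩ := hM.exists_elimination (hq j) (t j)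
  have hC : Fintype.card {v // v ∉ F} + F.card = n := by
    rw [Fintype.card_subtype_compl, hn, Fintype.card_coe, Nat.sub_add_cancel]
    exact hn ▸ F.card_le_univ
  rcases Nat.eq_zero_or_pos n with hn0 | hn0
  · have : IsEmpty V := Fintype.card_eq_zero_iff.1 (hn.trans hn0)
    exact ⟨1, 0, 0, 0, by simp, ⟨isEmptyElim, isEmptyElim, isEmptyElim⟩,
      by simp [numOffDiag], fun x => by simp [Subsingleton.elim x 0]⟩
  obtain ⟨U, d, ℓ, K, hK, hU⟩ := ih _ (by omega) (j + 1) hS rfl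
  obtain ⟨U', d', ℓ', hU'⟩ := hextend U d ℓ K _ _ _ hU (hc1 _) (by linarith [hc1 (j + 1)])
  have hn1 : (1 : ℝ) ≤ n := mod_cast hn0
  have hF' : (n : ℝ) ≤ 10 * F.card := mod_cast hn ▸ hF
  have hC' : (Fintype.card {v // v ∉ F} : ℝ) + F.card = n := mod_cast hC
  have hCn : (Fintype.card {v // v ∉ F} : ℝ) ≤ 9 / 10 * n := by linarith
  refine ⟨U', d', ℓ', K + 1, ?_, hU'.mono hM.posDef.posSemidef
    (mul_pos (by positivity) (by linarith [hc1 (j + 1)])) ?_ ?_ ?_⟩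
  · refine le_max_of_le_right ?_
    have := hK.trans (max_le hn1 (by linarith))
    rw [pow_succ', hn]
    gcongr
  · rw [hn]
    exact fill_add_le (by positivity) (by linarith) hCn (by positivity) (hT0 _) (hT j)
  · linarith [hc j]
  · have hgrow : (1 + (1 / 2) ^ t j) ^ 2 * c (j + 1) ≤ c j :=
      le_trans (le_mul_of_one_le_left (mul_nonneg (sq_nonneg _) (zero_le_one.trans (hc1 _)))
        (le_add_of_nonneg_right (by positivity))) (hc j)
    linarith

end LevelFactorization

section Parameters

open Filter Matrix

theorem exists_exp_log_sq_le_mul_pow (a : ℝ) {r : ℝ} (hr : 1 < r) :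
    ∃ B : ℝ, ∀ j : ℕ, Real.exp (a * Real.log (j + 2) ^ 2) ≤ B * r ^ j := by
  have hlittle : (fun x : ℝ => a * Real.log x ^ 2) =o[atTop] (id : ℝ → ℝ) :=
    (Real.isLittleO_pow_log_id_atTop (n := 2)).const_mul_left a
  have htendsto : Tendsto (fun j : ℕ => (j : ℝ) + 2) atTop atTop :=
    tendsto_natCast_atTop_atTop.atTop_add tendsto_const_nhds
  have hratio : ∀ᶠ j : ℕ in atTop,
      Real.exp (a * Real.log (j + 2) ^ 2) / r ^ j ≤ r ^ 2 := by
    filter_upwards [htendsto.eventually (hlittle.def (Real.log_pos hr))] with j hj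
    have hj' : a * Real.log (j + 2) ^ 2 ≤ Real.log r * (j + 2) := by
      simpa only [id, Real.norm_eq_abs, abs_of_nonneg (by positivity : (0 : ℝ) ≤ j + 2)] using
        (le_abs_self _).trans hj
    rw [div_le_iff₀ (by positivity), ← pow_add, ← Real.le_log_iff_exp_le (by positivity),
      Real.log_pow]
    push_cast
    linarith
  obtain ⟨B, hB⟩ := (isBoundedUnder_of_eventually_le hratio).bddAbove_range
  exact ⟨B, fun j => (div_le_iff₀ (by positivity)).1 (hB ⟨j, rfl⟩)⟩

/-- The sparsification parameter at depth `j` of the recursion, chosen so that the relative errors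
of all rounds are summable. -/
def sparsityParam (j : ℕ) : ℕ := 20 * (j + 2) ^ 2

/-- The number of Jacobi steps at depth `j` of the recursion, chosen so that the relative errors of
all rounds are summable. -/
def iterationParam (j : ℕ) : ℕ := 2 * Nat.clog 2 (j + 2) + 2

theorem le_two_pow_iterationParam (j : ℕ) : 4 * (j + 2) ^ 2 ≤ 2 ^ iterationParam j := by
  have hclog := Nat.le_pow_clog one_lt_two (j + 2)
  calc 4 * (j + 2) ^ 2 ≤ 4 * (2 ^ Nat.clog 2 (j + 2)) ^ 2 := by gcongr
    _ = 2 ^ iterationParam j := by rw [iterationParam, ← pow_mul]; ring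

theorem clog_two_add_two_le {n : ℕ} (hn : 2 ≤ n) :
    (Nat.clog 2 n + 2 : ℝ) ≤ 4 * Real.logb 2 n := by
  have hlog : 1 ≤ Real.logb 2 n := by
    rw [Real.le_logb_iff_rpow_le one_lt_two (by positivity), Real.rpow_one]
    exact_mod_cast hn
  have hclog : (Nat.clog 2 n : ℝ) < Real.logb 2 n + 1 := by
    rw [← Real.natCeil_logb_natCast]
    exact Nat.ceil_lt_add_one (zero_le_one.trans hlog)
  linarith

theorem iterationParam_add_one_le (j : ℕ) :
    (iterationParam j + 1 : ℝ) ≤ 8 * Real.logb 2 (j + 2) := by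
  have := clog_two_add_two_le (Nat.le_add_left 2 j)
  rw [iterationParam]
  push_cast at this ⊢
  linarith

theorem sparsityParam_sq_le (j : ℕ) : (4 * sparsityParam j ^ 2 + 1 : ℝ) ≤ (j + 2) ^ 15 := by
  have hj : (2 : ℝ) ≤ j + 2 := le_add_of_nonneg_left j.cast_nonneg
  have hpow : (1 : ℝ) ≤ (j + 2) ^ 4 := one_le_pow₀ (by linarith)
  calc (4 * sparsityParam j ^ 2 + 1 : ℝ) = 1600 * (j + 2) ^ 4 + 1 := by
        rw [sparsityParam]; push_cast; ring
    _ ≤ 2 ^ 11 * (j + 2) ^ 4 := by linarith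
    _ ≤ (j + 2) ^ 11 * (j + 2) ^ 4 := by gcongr
    _ = (j + 2) ^ 15 := by ring

theorem exists_fill_le_mul_pow {r : ℝ} (hr : 1 < r) :
    ∃ B : ℝ, ∀ j, (4 * sparsityParam j ^ 2 + 1 : ℝ) ^ (iterationParam j + 1) ≤ B * r ^ j := by
  obtain ⟨B, hB⟩ := exists_exp_log_sq_le_mul_pow (15 * 8 / Real.log 2) hr
  refine ⟨B, fun j => le_trans ?_ (hB j)⟩
  have hlog : 0 ≤ Real.log (j + 2) := Real.log_nonneg (by linarith [j.cast_nonneg (α := ℝ)])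
  calc (4 * sparsityParam j ^ 2 + 1 : ℝ) ^ (iterationParam j + 1)
      ≤ ((j + 2) ^ 15) ^ (iterationParam j + 1) := by
        gcongr
        exact sparsityParam_sq_le j
    _ = Real.exp (15 * (iterationParam j + 1) * Real.log (j + 2)) := by
        rw [← pow_mul, ← Real.exp_log (by positivity : (0 : ℝ) < (j + 2) ^ _), Real.log_pow]
        push_cast
        rfl
    _ ≤ Real.exp (15 * (8 * Real.logb 2 (j + 2)) * Real.log (j + 2)) := by
        gcongr
        exact iterationParam_add_one_le j
    _ = Real.exp (15 * 8 / Real.log 2 * Real.log (j + 2) ^ 2) := by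
        rw [Real.logb]
        congr 1
        ring

/-- The errors telescope, since `1 / (j + 2) ^ 2 ≤ 1 / (j + 1) - 1 / (j + 2)`. -/
theorem levelError_mul_exp_le (j : ℕ) :
    (1 + 10 / sparsityParam j) * ((1 + (1 / 2) ^ iterationParam j) ^ 2 *
      Real.exp (1 / ((j + 1 : ℕ) + 1))) ≤ Real.exp (1 / (j + 1)) := by
  set N : ℝ := (j + 2) ^ 2 with hN
  have hsparse : 1 + 10 / (sparsityParam j : ℝ) ≤ Real.exp (1 / (2 * N)) := by
    have : 10 / (sparsityParam j : ℝ) = 1 / (2 * N) := by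
      rw [sparsityParam, hN]
      push_cast
      field_simp
      norm_num
    rw [this, add_comm]
    exact Real.add_one_le_exp _
  have hpow : (1 / 2 : ℝ) ^ iterationParam j ≤ 1 / (4 * N) := by
    rw [_root_.one_div_pow]
    refine one_div_le_one_div_of_le (by positivity) ?_
    rw [hN]
    exact_mod_cast le_two_pow_iterationParam j
  have hjacobi : (1 + (1 / 2 : ℝ) ^ iterationParam j) ^ 2 ≤ Real.exp (1 / (2 * N)) := by
    calc (1 + (1 / 2 : ℝ) ^ iterationParam j) ^ 2 ≤ Real.exp (1 / (4 * N)) ^ 2 := by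
          gcongr
          linarith [Real.add_one_le_exp (1 / (4 * N))]
      _ = Real.exp (1 / (2 * N)) := by
          rw [← Real.exp_nat_mul]
          congr 1
          field_simp
          norm_num
  calc _ ≤ Real.exp (1 / (2 * N)) * (Real.exp (1 / (2 * N)) *
        Real.exp (1 / ((j + 1 : ℕ) + 1))) := by gcongr
    _ = Real.exp (1 / N + 1 / (j + 2)) := by
        rw [← Real.exp_add, ← Real.exp_add]
        congr 1
        push_cast
        field_simp
        ring
    _ ≤ Real.exp (1 / (j + 1)) := by
        rw [Real.exp_le_exp, hN, div_add_div _ _ (by positivity) (by positivity),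
          div_le_div_iff₀ (by positivity) (by positivity)]
        nlinarith [j.cast_nonneg (α := ℝ)]

/-- The fill `B * r ^ j` per row at depth `j` is summable against the geometric decay `9 / 10` of
the dimension as soon as `9 / 10 * r < 1`; here `r = 21 / 20`. -/
theorem exists_uniform_levelFactorization :
    ∃ T : ℝ, 0 ≤ T ∧ ∀ (V : Type*) [Fintype V] [DecidableEq V] (M : Matrix V V ℝ), IsSDDMOn M →
      ∃ U d ℓ K, (10 / 9 : ℝ) ^ K ≤ max (1 : ℝ) (10 / 9 * Fintype.card V) ∧
        IsLevelFactorization M U d ℓ K (T * Fintype.card V) (Real.exp 2) (Real.exp 2) := by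
  obtain ⟨B, hB⟩ := exists_fill_le_mul_pow (r := 21 / 20) (by norm_num)
  have hB0 : 0 ≤ B := by simpa using (by positivity : (0 : ℝ) ≤ _).trans (hB 0)
  refine ⟨B / 0.055, by positivity, fun V _ _ M hM => ?_⟩
  have hexp : 3 / 2 * Real.exp 1 ≤ Real.exp 2 := by
    calc 3 / 2 * Real.exp 1 ≤ Real.exp 1 * Real.exp 1 := by
          gcongr
          linarith [Real.exp_one_gt_d9]
      _ = Real.exp 2 := by rw [← Real.exp_add, one_add_one_eq_two]
  obtain ⟨U, d, ℓ, K, hK, hU⟩ := exists_levelFactorization (q := sparsityParam)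
    (t := iterationParam) (T := fun j => B * (21 / 20) ^ j / 0.055)
    (c := fun j => Real.exp (1 / ((j : ℝ) + 1)))
    (fun j => by rw [sparsityParam]; linarith [Nat.one_le_pow 2 (j + 2) (Nat.succ_pos _)])
    (fun j => by positivity) (fun j => Real.one_le_exp (by positivity))
    (fun j => (add_le_add_left (hB j) _).trans_eq (by ring)) levelError_mul_exp_le 0 hM
  simp only [Nat.cast_zero, zero_add, div_one, pow_zero, mul_one] at hU
  exact ⟨U, d, ℓ, K, hK, hU.mono hM.posDef.posSemidef (by positivity) le_rfl (by gcongr; norm_num)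
    hexp⟩

end Parameters

/-! ## Arithmetic circuits for substitution -/

namespace ArithCircuit

variable {ι : Type} {s : ℕ}

/-- The depth of a wire, extending `gateDepth` to inputs, which have depth `0`. -/
def wireDepth (c : ArithCircuit ι s) (w : ι ⊕ Fin s) : ℕ :=
  Sum.elim (fun _ => 0) c.gateDepth w

/-- The embedding of the wires of a circuit in those of a circuit with one more gate. -/
def liftWire (w : ι ⊕ Fin s) : ι ⊕ Fin (s + 1) := w.map id Fin.castSucc

variable (c : ArithCircuit ι s) (op : ArithOp) (l r : ι ⊕ Fin s)

theorem value_snoc_liftWire (w : ι ⊕ Fin s) (x : ι → ℝ) :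
    (snoc c op l r).value x (liftWire w) = c.value x w := by
  rcases w with w | w
  · rfl
  · simp [liftWire, value, gateValue]

theorem value_snoc_last (x : ι → ℝ) :
    (snoc c op l r).value x (.inr (Fin.last s)) = op.apply (c.value x l) (c.value x r) := by
  simp [value, gateValue]

theorem wireDepth_snoc_liftWire (w : ι ⊕ Fin s) :
    (snoc c op l r).wireDepth (liftWire w) = c.wireDepth w := by
  rcases w with w | w
  · rfl
  · simp [liftWire, wireDepth, gateDepth]

theorem wireDepth_snoc_last :
    (snoc c op l r).wireDepth (.inr (Fin.last s)) = max (c.wireDepth l) (c.wireDepth r) + 1 := by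
  simp [wireDepth, gateDepth]

theorem depth_snoc_le :
    (snoc c op l r).depth ≤ max c.depth (max (c.wireDepth l) (c.wireDepth r) + 1) := by
  refine Finset.sup_le fun i _ => ?_
  induction i using Fin.lastCases with
  | last => exact le_max_of_le_right (wireDepth_snoc_last c op l r).le
  | cast i =>
    have : (snoc c op l r).gateDepth i.castSucc = c.gateDepth i := by simp [gateDepth]
    rw [this]
    exact le_max_of_le_left (Finset.le_sup (f := c.gateDepth) (Finset.mem_univ i))

end ArithCircuit

/-- A circuit that never divides by zero on any member of the family `inp` of inputs. The values
at its wires are functions on the index type `Θ` of the family. -/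
structure SafeCircuit {ι Θ : Type} (inp : Θ → ι → ℝ) where
  size : ℕ
  circuit : ArithCircuit ι size
  divSafe : ∀ θ, circuit.DivSafe (inp θ)

namespace SafeCircuit

variable {ι Θ : Type} {inp : Θ → ι → ℝ}

/-- The circuit without gates. -/
def nil (inp : Θ → ι → ℝ) : SafeCircuit inp := ⟨0, .nil, fun _ => trivial⟩

/-- Some wire of depth at most `d` carries the value `g`. -/
def Has (c : SafeCircuit inp) (g : Θ → ℝ) (d : ℕ) : Prop :=
  ∃ w, (∀ θ, c.circuit.value (inp θ) w = g θ) ∧ c.circuit.wireDepth w ≤ d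

/-- `c'` carries all the values of `c`, and has at most `k` more gates, of depth at most `D`. -/
structure Extends (c c' : SafeCircuit inp) (k D : ℕ) : Prop where
  has : ∀ g d, c.Has g d → c'.Has g d
  size_le : c'.size ≤ c.size + k
  depth_le : c'.circuit.depth ≤ max c.circuit.depth D

theorem Has.mono {c : SafeCircuit inp} {g : Θ → ℝ} {d d' : ℕ} (h : c.Has g d) (hd : d ≤ d') :
    c.Has g d' :=
  h.imp fun _ hw => ⟨hw.1, hw.2.trans hd⟩

theorem Extends.refl (c : SafeCircuit inp) (k D : ℕ) : c.Extends c k D :=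
  ⟨fun _ _ h => h, Nat.le_add_right _ _, le_max_left _ _⟩

theorem Extends.trans {c c' c'' : SafeCircuit inp} {k k' D D' : ℕ} (h : c.Extends c' k D)
    (h' : c'.Extends c'' k' D') (hD : D ≤ D') : c.Extends c'' (k + k') D' where
  has g d hg := h'.has g d (h.has g d hg)
  size_le := by
    have := h.size_le
    have := h'.size_le
    omega
  depth_le := by
    have := h.depth_le
    have := h'.depth_le
    omega

variable (c : SafeCircuit inp)

theorem has_input (i : ι) (d : ℕ) : c.Has (fun θ => inp θ i) d :=
  ⟨.inl i, fun _ => rfl, Nat.zero_le _⟩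

theorem exists_gate {op : ArithOp} (hop : op ≠ .div) {g₁ g₂ : Θ → ℝ} {d : ℕ} (h₁ : c.Has g₁ d)
    (h₂ : c.Has g₂ d) :
    ∃ c' : SafeCircuit inp, c.Extends c' 1 (d + 1) ∧
      c'.Has (fun θ => op.apply (g₁ θ) (g₂ θ)) (d + 1) := by
  obtain ⟨l, hl, hld⟩ := h₁
  obtain ⟨r, hr, hrd⟩ := h₂
  refine ⟨⟨c.size + 1, .snoc c.circuit op l r, fun θ => ⟨c.divSafe θ, fun h => absurd h hop⟩⟩,
    ⟨?_, le_rfl, ?_⟩, ?_⟩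
  · rintro g d ⟨w, hw, hwd⟩
    exact ⟨ArithCircuit.liftWire w, fun θ => by rw [ArithCircuit.value_snoc_liftWire, hw],
      by rwa [ArithCircuit.wireDepth_snoc_liftWire]⟩
  · refine (ArithCircuit.depth_snoc_le _ _ _ _).trans ?_
    omega
  · refine ⟨.inr (Fin.last _), fun θ => by rw [ArithCircuit.value_snoc_last, hl, hr], ?_⟩
    rw [ArithCircuit.wireDepth_snoc_last]
    omega

variable {α : Type*} {S : Finset α}

theorem exists_forall {g : α → Θ → ℝ} {k : α → ℕ} {d : ℕ}
    (h : ∀ a ∈ S, ∀ c' : SafeCircuit inp, (∀ g d, c.Has g d → c'.Has g d) →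
      ∃ c'' : SafeCircuit inp, c'.Extends c'' (k a) d ∧ c''.Has (g a) d) :
    ∃ c' : SafeCircuit inp, c.Extends c' (∑ a ∈ S, k a) d ∧ ∀ a ∈ S, c'.Has (g a) d := by
  classical
  induction S using Finset.induction_on with
  | empty => exact ⟨c, Extends.refl c _ d, by simp⟩
  | insert a S ha ih =>
    obtain ⟨c₁, h₁, hS⟩ := ih fun b hb => h b (Finset.mem_insert_of_mem hb)
    obtain ⟨c₂, h₂, hg⟩ := h a (Finset.mem_insert_self _ _) c₁ h₁.has
    refine ⟨c₂, ?_, Finset.forall_mem_insert _ _ _ |>.2 ⟨hg, fun b hb => h₂.has _ _ (hS b hb)⟩⟩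
    rw [Finset.sum_insert ha, add_comm]
    exact h₁.trans h₂ le_rfl

/-- A balanced binary tree of additions. -/
theorem exists_sum (hS : S.Nonempty) {g : α → Θ → ℝ} {d : ℕ} (h : ∀ a ∈ S, c.Has (g a) d) {p : ℕ}
    (hp : S.card ≤ 2 ^ p) :
    ∃ c' : SafeCircuit inp, c.Extends c' (S.card - 1) (d + p) ∧
      c'.Has (fun θ => ∑ a ∈ S, g a θ) (d + p) := by
  classical
  induction p generalizing S c with
  | zero =>
    obtain ⟨a, rfl⟩ := Finset.card_eq_one.1 (hp.antisymm hS.card_pos)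
    exact ⟨c, Extends.refl c _ _, by simpa using h a⟩
  | succ p ih =>
    rcases Nat.eq_or_lt_of_le hS.card_pos with hone | htwo
    · obtain ⟨a, rfl⟩ := Finset.card_eq_one.1 hone.symm
      exact ⟨c, Extends.refl c _ _, by simpa using (h a (by simp)).mono (Nat.le_add_right d _)⟩
    rw [pow_succ] at hp
    obtain ⟨L, hLS, hL⟩ := Finset.exists_subset_card_eq (Nat.div_le_self S.card 2)
    have hR : (S \ L).card = S.card - S.card / 2 := by rw [Finset.card_sdiff_of_subset hLS, hL]
    obtain ⟨c₁, hc₁, hsumL⟩ := ih c (S := L) (Finset.card_pos.1 (by omega))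
      (fun a ha => h a (hLS ha)) (by omega)
    obtain ⟨c₂, hc₂, hsumR⟩ := ih c₁ (S := S \ L) (Finset.card_pos.1 (by omega))
      (fun a ha => hc₁.has _ _ (h a (Finset.sdiff_subset ha))) (by omega)
    obtain ⟨c₃, hc₃, hsum⟩ := c₂.exists_gate (op := .add) nofun hsumR (hc₂.has _ _ hsumL)
    have hsize : L.card - 1 + ((S \ L).card - 1) + 1 = S.card - 1 := by omega
    exact ⟨c₃, hsize ▸ (hc₁.trans hc₂ le_rfl).trans hc₃ (Nat.le_succ _),
      by simpa only [ArithOp.apply, Finset.sum_sdiff hLS, add_assoc] using hsum⟩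

theorem exists_sub_sum_mul {u x : α → Θ → ℝ} {b : Θ → ℝ} {d : ℕ} (hu : ∀ a ∈ S, c.Has (u a) d)
    (hx : ∀ a ∈ S, c.Has (x a) d) (hb : c.Has b d) {p : ℕ} (hp : S.card ≤ 2 ^ p) :
    ∃ c' : SafeCircuit inp, c.Extends c' (2 * S.card) (d + (p + 2)) ∧
      c'.Has (fun θ => b θ - ∑ a ∈ S, u a θ * x a θ) (d + (p + 2)) := by
  rcases S.eq_empty_or_nonempty with rfl | hS
  · exact ⟨c, Extends.refl c _ _, by simpa using hb.mono (Nat.le_add_right d _)⟩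
  obtain ⟨c₁, hc₁, hprod⟩ := c.exists_forall (g := fun a θ => u a θ * x a θ) (k := fun _ => 1)
    fun a ha c' hc' => c'.exists_gate (op := .mul) nofun (hc' _ _ (hu a ha)) (hc' _ _ (hx a ha))
  obtain ⟨c₂, hc₂, hsum⟩ := c₁.exists_sum hS hprod hp
  obtain ⟨c₃, hc₃, hsub⟩ := c₂.exists_gate (op := .sub) nofun
    (hc₂.has _ _ (hc₁.has _ _ (hb.mono (by omega)))) hsum
  have hsize : ∑ _a ∈ S, 1 + (S.card - 1) + 1 = 2 * S.card := by
    have := hS.card_pos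
    simp only [Finset.sum_const, smul_eq_mul, mul_one]
    omega
  have hdepth : d + 1 + p + 1 = d + (p + 2) := by omega
  exact ⟨c₃, hsize ▸ hdepth ▸ (hc₁.trans hc₂ (by omega)).trans hc₃ (by omega), hdepth ▸ hsub⟩

end SafeCircuit

section Substitution

open Matrix

variable {V : Type} [Fintype V] [DecidableEq V] {A : Matrix V V ℝ} {ℓ : V → ℕ} {K p : ℕ}

theorem IsLevelTriangular.det_eq_one (h : IsLevelTriangular A ℓ K) : A.det = 1 := by
  have hblock : A.BlockTriangular ℓ := fun i j hij => by
    by_contra hA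
    have hne : i ≠ j := by
      rintro rfl
      exact hij.false
    exact hij.not_gt (h.level_lt_level i j hne hA)
  rw [hblock.det]
  refine Finset.prod_eq_one fun k _ => ?_
  have hone : A.toSquareBlock ℓ k = 1 := by
    ext i j
    by_cases hij : i = j
    · rw [hij, one_apply_eq]
      exact h.diag_eq_one _
    · rw [one_apply_ne hij]
      by_contra hA
      have := h.level_lt_level i j (Subtype.val_injective.ne hij) hA
      rw [i.2, j.2] at this
      exact this.false
  rw [hone, det_one]

theorem inv_mulVec_apply_eq_sub_sum (hdet : IsUnit A.det) {v : V} (hv : A v v = 1) (b : V → ℝ) :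
    (A⁻¹ *ᵥ b) v = b v - ∑ u ∈ offDiagSupport A v, A v u * (A⁻¹ *ᵥ b) u := by
  have hsolve : ∑ u, A v u * (A⁻¹ *ᵥ b) u = b v := by
    have : A *ᵥ A⁻¹ *ᵥ b = b := by rw [mulVec_mulVec, mul_nonsing_inv _ hdet, one_mulVec]
    exact congrFun this v
  have hsupport : ∑ u ∈ Finset.univ.erase v, A v u * (A⁻¹ *ᵥ b) u =
      ∑ u ∈ offDiagSupport A v, A v u * (A⁻¹ *ᵥ b) u := by
    refine (Finset.sum_subset (fun u hu => ?_) fun u hu hu' => ?_).symm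
    · exact Finset.mem_erase.2 ⟨(mem_offDiagSupport.1 hu).1, Finset.mem_univ u⟩
    · have : A v u = 0 := by
        by_contra hne
        exact hu' (mem_offDiagSupport.2 ⟨Finset.ne_of_mem_erase hu, hne⟩)
      rw [this, zero_mul]
  rw [← hsolve, ← Finset.add_sum_erase _ _ (Finset.mem_univ v), hv, one_mul, hsupport,
    add_sub_cancel_right]

/-- The inputs of the circuits of `SolvableIn`: the entries of `A` and those of the right-hand
side. -/
def systemInput (A : Matrix V V ℝ) (b : V → ℝ) : (V × V) ⊕ V → ℝ :=
  Sum.elim (fun p => A p.1 p.2) b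

theorem SafeCircuit.exists_inv_mulVec_apply (hdet : IsUnit A.det) {v : V} (hv : A v v = 1)
    (c : SafeCircuit (systemInput A)) {d : ℕ}
    (h : ∀ u ∈ offDiagSupport A v, c.Has (fun b => (A⁻¹ *ᵥ b) u) d) (hp : Fintype.card V ≤ 2 ^ p) :
    ∃ c' : SafeCircuit (systemInput A),
      c.Extends c' (2 * (offDiagSupport A v).card) (d + (p + 2)) ∧
        c'.Has (fun b => (A⁻¹ *ᵥ b) v) (d + (p + 2)) := by
  simp only [inv_mulVec_apply_eq_sub_sum hdet hv]
  exact c.exists_sub_sum_mul (fun u _ => c.has_input (.inl (v, u)) d) h (c.has_input (.inr v) d)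
    ((Finset.card_le_univ _).trans hp)

namespace IsLevelTriangular

omit [DecidableEq V] in
theorem level_lt_of_mem_offDiagSupport (h : IsLevelTriangular Aᵀ ℓ K) {u v : V}
    (hu : u ∈ offDiagSupport A v) : ℓ u < ℓ v :=
  h.level_lt_level u v (mem_offDiagSupport.1 hu).1 (mem_offDiagSupport.1 hu).2

theorem exists_circuit (h : IsLevelTriangular Aᵀ ℓ K) (hp : Fintype.card V ≤ 2 ^ p) (k : ℕ) :
    ∃ c, (SafeCircuit.nil (systemInput A)).Extends c
        (∑ v with ℓ v ≤ k, 2 * (offDiagSupport A v).card) (k * (p + 2)) ∧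
      ∀ v, ℓ v ≤ k → c.Has (fun b => (A⁻¹ *ᵥ b) v) (k * (p + 2)) := by
  have hdet : IsUnit A.det := by rw [← det_transpose, h.det_eq_one]; exact isUnit_one
  induction k with
  | zero =>
    refine ⟨_, .refl _ _ _, fun v hv => ?_⟩
    have hempty : offDiagSupport A v = ∅ := Finset.eq_empty_of_forall_notMem fun u hu =>
      (h.level_lt_of_mem_offDiagSupport hu).not_ge (hv.trans (Nat.zero_le _))
    simp only [inv_mulVec_apply_eq_sub_sum hdet (h.diag_eq_one v), hempty, Finset.sum_empty,
      sub_zero]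
    exact SafeCircuit.has_input (inp := systemInput A) _ (Sum.inr v) _
  | succ k ih =>
    obtain ⟨c, hc, hsol⟩ := ih
    have hbelow : ∀ v ∈ ({v | ℓ v = k + 1} : Finset V), ∀ u ∈ offDiagSupport A v, ℓ u ≤ k :=
      fun v hv u hu => Nat.le_of_lt_succ
        ((h.level_lt_of_mem_offDiagSupport hu).trans_eq (Finset.mem_filter.1 hv).2)
    obtain ⟨c', hc', hsol'⟩ := c.exists_forall (S := {v | ℓ v = k + 1})
      (g := fun v b => (A⁻¹ *ᵥ b) v) (k := fun v => 2 * (offDiagSupport A v).card)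
      (d := k * (p + 2) + (p + 2)) fun v hv c' hcc' =>
        c'.exists_inv_mulVec_apply hdet (h.diag_eq_one v)
          (fun u hu => hcc' _ _ (hsol u (hbelow v hv u hu))) hp
    rw [← Nat.succ_mul] at hc' hsol'
    have hmono : k * (p + 2) ≤ (k + 1) * (p + 2) := Nat.mul_le_mul_right _ k.le_succ
    refine ⟨c', ?_, fun v hv => ?_⟩
    · have hsplit : ({v | ℓ v ≤ k + 1} : Finset V) =
          ({v | ℓ v ≤ k} : Finset V) ∪ ({v | ℓ v = k + 1} : Finset V) := by
        ext v
        simp only [Finset.mem_filter, Finset.mem_univ, true_and, Finset.mem_union]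
        omega
      rw [hsplit, Finset.sum_union (Finset.disjoint_filter.2 fun v _ _ => by omega)]
      exact hc.trans hc' hmono
    · rcases hv.lt_or_eq with hlt | heq
      · exact (hc'.has _ _ (hsol v (Nat.le_of_lt_succ hlt))).mono hmono
      · exact hsol' v (by simpa using heq)

theorem solvableIn {n : ℕ} {A : Matrix (Fin n) (Fin n) ℝ} {ℓ : Fin n → ℕ}
    (h : IsLevelTriangular Aᵀ ℓ K) :
    SolvableIn A (2 * numOffDiag A) ((K - 1) * (Nat.clog 2 n + 2) : ℕ) := by
  have hdet : IsUnit A.det := by rw [← det_transpose, h.det_eq_one]; exact isUnit_one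
  obtain ⟨c, hc, hsol⟩ := h.exists_circuit
    ((Fintype.card_fin n).trans_le (Nat.le_pow_clog one_lt_two n)) (K - 1)
  choose out hout _ using fun v => hsol v (Nat.le_sub_one_of_lt (h.level_lt v))
  refine ⟨c.size, c.circuit, out, ?_, ?_, fun b => ⟨c.divSafe b, ?_⟩⟩
  · have := hc.size_le
    rw [Finset.filter_true_of_mem fun v _ => Nat.le_sub_one_of_lt (h.level_lt v), ← Finset.mul_sum,
      SafeCircuit.nil, zero_add] at this
    exact_mod_cast this
  · exact_mod_cast hc.depth_le.trans_eq (max_eq_right (Nat.zero_le _))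
  · have : (fun i => c.circuit.value (systemInput A b) (out i)) = A⁻¹ *ᵥ b :=
      funext fun v => hout v b
    rw [systemInput] at this
    rw [this, mulVec_mulVec, mul_nonsing_inv _ hdet, one_mulVec]

theorem solvableIn_transpose {n : ℕ} {A : Matrix (Fin n) (Fin n) ℝ} {ℓ : Fin n → ℕ}
    (h : IsLevelTriangular A ℓ K) :
    SolvableIn Aᵀ (2 * numOffDiag A) ((K - 1) * (Nat.clog 2 n + 2) : ℕ) :=
  numOffDiag_transpose A ▸ solvableIn (A := Aᵀ) h

end IsLevelTriangular

end Substitution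

section Assembly

open Matrix

theorem SolvableIn.mono {n : ℕ} {A : Matrix (Fin n) (Fin n) ℝ} {work work' depth depth' : ℝ}
    (h : SolvableIn A work depth) (hwork : work ≤ work') (hdepth : depth ≤ depth') :
    SolvableIn A work' depth' := by
  obtain ⟨s, c, out, hs, hc, hout⟩ := h
  exact ⟨s, c, out, hs.trans hwork, hc.trans hdepth, hout⟩

theorem SpectralBounds.spectralApprox {n : ℕ} {ε : ℝ} {A B : Matrix (Fin n) (Fin n) ℝ}
    (h : SpectralBounds (Real.exp ε) (Real.exp ε) A B) (hA : A.IsSymm) (hB : B.IsSymm) :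
    SpectralApprox ε A B where
  left := posSemidef_of_quadForm_nonneg ((hB.smul _).sub hA) fun x => by
    rw [quadForm_sub, quadForm_smul]
    exact sub_nonneg.2 (h x).1
  right := posSemidef_of_quadForm_nonneg (hA.sub (hB.smul _)) fun x => by
    rw [quadForm_sub, quadForm_smul, Real.exp_neg, sub_nonneg, inv_mul_le_iff₀ (Real.exp_pos ε)]
    exact (h x).2

theorem IsLevelTriangular.blockTriangular_id {V : Type*} [LinearOrder V] {A : Matrix V V ℝ}
    {ℓ : V → ℕ} {K : ℕ} (h : IsLevelTriangular A ℓ K) (hℓ : Monotone ℓ) :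
    A.BlockTriangular id := fun i j hij => by
  by_contra hA
  exact (hℓ hij.le).not_gt (h.level_lt_level i j hij.ne' hA)

theorem isSymm_transpose_mul_diagonal_mul {V : Type*} [Fintype V] [DecidableEq V]
    (U : Matrix V V ℝ) (d : V → ℝ) : (Uᵀ * diagonal d * U).IsSymm := by
  rw [IsSymm, transpose_mul, transpose_mul, transpose_transpose, diagonal_transpose,
    Matrix.mul_assoc]

theorem numLevels_sub_one_le {n K : ℕ}
    (hK : (10 / 9 : ℝ) ^ K ≤ max (1 : ℝ) (10 / 9 * n)) :
    ((K - 1 : ℕ) : ℝ) ≤ 10 * Real.log n := by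
  rcases K with _ | k
  · simpa using Real.log_natCast_nonneg n
  have hone : (1 : ℝ) < (10 / 9) ^ (k + 1) := one_lt_pow₀ (by norm_num) k.succ_ne_zero
  have hpow : (10 / 9 : ℝ) ^ k ≤ n := by
    have := (le_max_iff.1 hK).resolve_left hone.not_ge
    rw [pow_succ] at this
    linarith
  have hlog : 1 / 10 ≤ Real.log (10 / 9) := by
    have := Real.one_sub_inv_le_log_of_pos (show (0 : ℝ) < 10 / 9 by norm_num)
    norm_num at this ⊢
    exact this
  have hle := Real.log_le_log (by positivity) hpow
  rw [Real.log_pow] at hle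
  rw [Nat.add_sub_cancel]
  nlinarith [k.cast_nonneg (α := ℝ)]

theorem numLevels_sub_one_mul_clog_le {n K : ℕ}
    (hK : (10 / 9 : ℝ) ^ K ≤ max (1 : ℝ) (10 / 9 * n)) :
    (((K - 1) * (Nat.clog 2 n + 2) : ℕ) : ℝ) ≤ 60 * Real.log n ^ 2 := by
  have hlevels := numLevels_sub_one_le hK
  rcases lt_or_ge n 2 with hn | hn
  · have hlog : Real.log n = 0 := by interval_cases n <;> simp
    have hzero : K - 1 = 0 := by
      rw [hlog, mul_zero] at hlevels
      exact_mod_cast hlevels.antisymm (Nat.cast_nonneg _)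
    simp [hzero, hlog]
  · have hlog2 : 2 / 3 < Real.log 2 := by linarith [Real.log_two_gt_d9]
    have hclog : (Nat.clog 2 n + 2 : ℝ) ≤ 6 * Real.log n := by
      refine (clog_two_add_two_le hn).trans ?_
      rw [Real.logb, mul_div_assoc', div_le_iff₀ (by linarith)]
      nlinarith [Real.log_natCast_nonneg n]
    push_cast
    calc ((K - 1 : ℕ) : ℝ) * (Nat.clog 2 n + 2) ≤ 10 * Real.log n * (6 * Real.log n) := by gcongr
      _ = 60 * Real.log n ^ 2 := by ring

end Assembly

/-- The rows and columns of `M` are simultaneously reordered by `σ`; `U *ᵥ x = b` is a back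
solve and `Uᵀ *ᵥ x = b` a forward solve. -/
theorem mainTheorem1 :
    ∃ C : ℝ, ∀ (n : ℕ) (M : Matrix (Fin n) (Fin n) ℝ), IsSDDM M →
      ∃ (σ : Equiv.Perm (Fin n)) (D U : Matrix (Fin n) (Fin n) ℝ),
        D.IsDiag ∧
        U.BlockTriangular id ∧
        (numNonzero U : ℝ) ≤ C * n ∧
        SpectralApprox 2 (Uᵀ * D * U) (M.submatrix σ σ) ∧
        SolvableIn U (C * n) (C * Real.log n ^ 2) ∧
        SolvableIn Uᵀ (C * n) (C * Real.log n ^ 2) := by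
  obtain ⟨T, hT, hfactor⟩ := exists_uniform_levelFactorization
  refine ⟨2 * T + 60, fun n M hM => ?_⟩
  obtain ⟨U, d, ℓ, K, hK, hU⟩ := hfactor (Fin n) M hM.isSDDMOn
  rw [Fintype.card_fin] at hK hU
  set σ := Tuple.sort ℓ
  have hσ := hU.submatrix σ
  have hTn : 0 ≤ T * n := by positivity
  have hsize : (numOffDiag (U.submatrix σ σ) : ℝ) ≤ T * n := hσ.numOffDiag_le
  have hwork : 2 * (numOffDiag (U.submatrix σ σ) : ℝ) ≤ (2 * T + 60) * n := by linarith
  have hdepth : (((K - 1) * (Nat.clog 2 n + 2) : ℕ) : ℝ) ≤ (2 * T + 60) * Real.log n ^ 2 :=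
    (numLevels_sub_one_mul_clog_le hK).trans (by gcongr; linarith)
  refine ⟨σ, Matrix.diagonal (d ∘ σ), U.submatrix σ σ, Matrix.isDiag_diagonal _,
    hσ.blockTriangular_id (Tuple.monotone_sort ℓ), ?_, ?_, ?_, ?_⟩
  · have : (numNonzero (U.submatrix σ σ) : ℝ) ≤ n + numOffDiag (U.submatrix σ σ) :=
      mod_cast numNonzero_le_add_numOffDiag (U.submatrix σ σ)
    linarith
  · exact hσ.spectralBounds.spectralApprox (isSymm_transpose_mul_diagonal_mul _ _)
      (hM.symm.submatrix σ)
  · exact hσ.transpose.solvableIn.mono hwork hdepth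
  · exact hσ.solvableIn_transpose.mono hwork hdepth
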